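/- **Conventions.** Let $r\in\{\infty,\omega\}$ and $n\ge 1$; $C^\omega$ means real analytic. Manifolds are Hausdorff and second countable; $M$ is a $C^r$ manifold of dimension $n$. Write $\mathbb R^{n+1}_1=\mathbb R\times\mathbb R^n$ with $\langle (s,x),(t,y)\rangle=-st+x\cdot y$, and $\tau(t,x)=t$. A (co-oriented) $C^r$ *wave front* $f:N^{m}\to\mathbb R^{m+1}$ is a $C^r$ map for which there is a $C^r$ map $\tilde\alpha:N\to(\mathbb R^{m+1})^*\setminus\{0\}$ with $\tilde\alpha_p\circ df_p=0$ for all $p$, such that $(f,[\tilde\alpha]):N\to\mathbb R^{m+1}\times P^*(\mathbb R^{m+1})$ is an immersion. A wave front $F:M\to\mathbb R^{n+1}_1$ is *null* if the vector field $\hat\xi$ along $F$ given by $\langle\hat\xi_p,\cdot\rangle=\tilde\alpha_p$ is light-like; its *E-normalized normal field* $\hat\xi_E$ is the light-like, future-pointing $C^r$ field along $F$ that is orthogonal to $dF(TM)$ and has Euclidean length $\sqrt2$. The *Legendrian lift* is $L_F=(F,\hat\xi_E):M\to\mathbb R^{n+1}_1\times\mathbb R^{n+1}_1$. $F$ is *L-complete*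 if, for the $C^r$ vector field $\xi_E$ on $M$ with $dF(\xi_E)=\hat\xi_E$, through every point passes an integral curve of $\xi_E$, defined on $\mathbb R$, whose image under $F$ is an entire light-like line. For a wave front $g:\Sigma^{n-1}\to\mathbb R^n$ with $C^r$ unit normal field $\nu$, the associated *normal form* is $G:\mathbb R\times\Sigma\to\mathbb R^{n+1}_1$, $G(t,x)=(0,g(x))+t(1,\nu(x))$, and $L_G(t,x)=(G(t,x),(1,\nu(x)))$. **Adopted sets.** Let $F:M\to\mathbb R^{n+1}_1$ be a $C^r$ null wave front and put $\hat\tau=\tau\circ F$. A non-empty open set $U\subset M$ is *$F$-adopted* if there are $\epsilon\in(0,\infty]$, $t_U\in\mathbb R$, an $(n-1)$-dimensional $C^r$ submanifold $\Sigma_U$ of $U$, a surjective $C^r$ submersion $\rho_U:U\to\Sigma_U$, and a $C^r$ wave front $g_U:\Sigma_U\to\mathbb R^n$ with unit normal field $\nu_U$, such that $\hat\xi_E(x)=(1,\nu_U(x))$ for $x\in\Sigma_U$, $(0,g_U(\rho_U(q)))=F(q)-\hat\tau(q)\,\hat\xi_E(\rho_U(q))$ for $q\in U$, and $q\mapsto(\hat\tau(q),\rho_U(q))$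 is a $C^r$ diffeomorphism of $U$ onto $(t_U-\epsilon,t_U+\epsilon)\times\Sigma_U$. Put $l_U=(g_U,\nu_U)$ and $L_U(t,x)=((0,g_U(x))+t(1,\nu_U(x)),(1,\nu_U(x)))$ on $\mathbb R\times\Sigma_U$. $U$ (with this data) is *strongly $F$-adopted* if $L_U$ is an embedding. For $p,q\in M$ write $p\approx q$ if there are strongly $F$-adopted neighbourhoods $U\ni p$, $V\ni q$, numbers $s,t\in\mathbb R$, and open neighbourhoods $A\subset\mathbb R\times\Sigma_U$ of $(s,\rho_U(p))$ and $B\subset\mathbb R\times\Sigma_V$ of $(t,\rho_V(q))$ with $L_U(s,\rho_U(p))=L_V(t,\rho_V(q))$ and $L_U(A)=L_V(B)$. $F$ is *admissible* if for all $p,q\in M$ either $p\approx q$, or there are strongly $F$-adopted neighbourhoods $U\ni p$ and $V\ni q$ such that $l_U(\Sigma_U)$ and $l_V(\Sigma_V)$ are transversal in $\mathbb R^n\times S^{n-1}$. **Theorem.** Let $F:M\to\mathbb R^{n+1}_1$ be a $C^r$ null wave front, and suppose that $r=\omega$ or that $F$ is admissible. Then there exist an $(n-1)$-dimensional $C^r$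 manifold $\Sigma_F$; a surjective $C^r$ submersion $\rho_F:M\to\Sigma_F$ with $\rho_F(p)=\rho_F(q)\iff p\approx q$ (so that $\Sigma_F=M/{\approx}$); and a $C^r$ wave front $g:\Sigma_F\to\mathbb R^n$ with $C^r$ unit normal field $\nu$, whose normal form $G:\mathbb R\times\Sigma_F\to\mathbb R^{n+1}_1$ (the *L-completion* of $F$) is an L-complete $C^r$ null wave front with E-normalized normal field $(t,x)\mapsto(1,\nu(x))$, such that $\Phi:M\to\mathbb R\times\Sigma_F$, $\Phi(p)=(\hat\tau(p),\rho_F(p))$, is a $C^r$ immersion and $$L_F=L_G\circ\Phi\quad\text{on } M .$$ Moreover, if $L_F$ is an embedding, then $\Phi(M)$ is open in $\mathbb R\times\Sigma_F$ and $\Phi$ is a $C^r$ diffeomorphism from $M$ onto $\Phi(M)$. -/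

import Mathlib

open Set Function
open scoped Manifold ContDiff InnerProductSpace

universe u

namespace NullFront

/-- Euclidean `n`-space `ℝⁿ₀`. -/
abbrev Euc (n : ℕ) : Type := EuclideanSpace ℝ (Fin n)

/-- Lorentz-Minkowski space `ℝⁿ⁺¹₁`, a point being written `(t, x)` with `t` the time coordinate
and `x` the spatial part. -/
abbrev Mink (n : ℕ) : Type := ℝ × Euc n

/-- The Lorentzian inner product of signature `(-+⋯+)`; `lorentz v` is the covector `⟨v, ·⟩`. -/
noncomputable def lorentz {n : ℕ} (v : Mink n) : Mink n →L[ℝ] ℝ :=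
  (-v.1) • ContinuousLinearMap.fst ℝ ℝ (Euc n)
    + (innerSL ℝ v.2).comp (ContinuousLinearMap.snd ℝ ℝ (Euc n))

/-- The height function `τ(v) = -⟨v, e₀⟩`, where `e₀ = (1, 0, …, 0)`. -/
noncomputable def height {n : ℕ} (v : Mink n) : ℝ :=
  -lorentz v ((1, 0) : Mink n)

section General

variable {E H M : Type*} [NormedAddCommGroup E] [NormedSpace ℝ E] [TopologicalSpace H]
  (I : ModelWithCorners ℝ E H) [TopologicalSpace M] [ChartedSpace H M]
variable {E' H' N : Type*} [NormedAddCommGroup E'] [NormedSpace ℝ E'] [TopologicalSpace H']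
  (J : ModelWithCorners ℝ E' H') [TopologicalSpace N] [ChartedSpace H' N]

/-- `C^r` immersions (between finite-dimensional manifolds). -/
def IsCrImmersion (r : WithTop ℕ∞) (f : M → N) : Prop :=
  ContMDiff I J r f ∧ ∀ p : M, Injective (mfderiv I J f p)

/-- `C^r` submersions (between finite-dimensional manifolds). -/
def IsCrSubmersion (r : WithTop ℕ∞) (f : M → N) : Prop :=
  ContMDiff I J r f ∧ ∀ p : M, Surjective (mfderiv I J f p)

/-- `C^r` embeddings: immersions that are homeomorphisms onto their image. -/
def IsCrEmbedding (r : WithTop ℕ∞) (f : M → N) : Prop :=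
  IsCrImmersion I J r f ∧ Topology.IsEmbedding f

/-- The differential `df_p(v) ∈ V` of a vector-valued map `f : M → V`. -/
noncomputable abbrev dvec {V : Type*} [NormedAddCommGroup V] [NormedSpace ℝ V]
    (f : M → V) (p : M) (v : TangentSpace I p) : V :=
  mfderiv I 𝓘(ℝ, V) f p v

/-- `f : M → V` is a co-orientable `C^r` wave front, with `α : M → V* ∖ {0}` a lift of its
projective Gauss map `[α] : M → P*(V)`. The tangent space of `P*(V)` at `[α p]` is
`V* / ℝ (α p)`, whence `(f, [α])` is an immersion at `p` if and only if no nonzero tangent vector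
`v` satisfies both `df v = 0` and `dα v ∈ ℝ (α p)`. -/
structure IsFrontWith {V : Type*} [NormedAddCommGroup V] [NormedSpace ℝ V]
    (r : WithTop ℕ∞) (f : M → V) (α : M → (V →L[ℝ] ℝ)) : Prop where
  contMDiff : ContMDiff I 𝓘(ℝ, V) r f
  contMDiff_gauss : ContMDiff I 𝓘(ℝ, V →L[ℝ] ℝ) r α
  ne_zero : ∀ p, α p ≠ 0
  mem_ker : ∀ (p : M) (v : TangentSpace I p), α p (dvec I f p v) = 0
  immersion : ∀ (p : M) (v : TangentSpace I p), dvec I f p v = 0 →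
    (∃ c : ℝ, dvec I α p v = c • α p) → v = 0

/-- `g : M → ℝⁿ₀` is a co-orientable `C^r` wave front with `C^r` unit normal vector field `ν`. -/
def IsFrontWithUnitNormal {n : ℕ} (r : WithTop ℕ∞) (g ν : M → Euc n) : Prop :=
  ContMDiff I 𝓘(ℝ, Euc n) r ν ∧ (∀ p, ‖ν p‖ = 1) ∧ IsFrontWith I r g (fun p => innerSL ℝ (ν p))

/-- `F : M → ℝⁿ⁺¹₁` is a (co-orientable) null `C^r` wave front: it is a wave front and the vector
field `ζ` along `F` that is dual to a lift of its projective Gauss map is light-like. -/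
def IsNullFront {n : ℕ} (r : WithTop ℕ∞) (F : M → Mink n) : Prop :=
  ∃ ζ : M → Mink n, IsFrontWith I r F (fun p => lorentz (ζ p)) ∧ ∀ p, lorentz (ζ p) (ζ p) = 0

/-- `ξ` is the E-normalized normal vector field along the null wave front `F`: it is normal to
`F`, light-like, future-pointing, and of Euclidean length `√2`. -/
structure IsENormal {n : ℕ} (r : WithTop ℕ∞) (F ξ : M → Mink n) : Prop where
  contMDiff : ContMDiff I 𝓘(ℝ, Mink n) r ξ
  normal : ∀ (p : M) (v : TangentSpace I p),
    lorentz (ξ p) (dvec I F p v) = 0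
  null : ∀ p, lorentz (ξ p) (ξ p) = 0
  future : ∀ p, 0 < (ξ p).1
  norm : ∀ p, Real.sqrt ((ξ p).1 ^ 2 + ‖(ξ p).2‖ ^ 2) = Real.sqrt 2

/-- The Legendrian lift `L_F = (F, ξ)` of a null wave front with E-normalized normal field `ξ`. -/
def legendrianLift {n : ℕ} (F ξ : M → Mink n) : M → Mink n × Mink n := fun p => (F p, ξ p)

theorem one_le_of_smooth_or_analytic {r : WithTop ℕ∞} (hr : r = ∞ ∨ r = ω) : 1 ≤ r := by
  rcases hr with rfl | rfl
  · exact_mod_cast (le_top : (1 : ℕ∞) ≤ ⊤)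
  · exact le_top

/-- L-completeness of a null wave front `F` with E-normalized normal vector field `ξ`. Here `X` is
the E-normalized null vector field, i.e. the `C^r` vector field with `dF(X) = ξ`: through every
point passes an integral curve of `X`, defined on `ℝ`, whose image under `F` is an entire
light-like line. -/
def IsLComplete {n : ℕ} (r : WithTop ℕ∞) (hr : r = ∞ ∨ r = ω) [IsManifold I r M]
    (F ξ : M → Mink n) : Prop :=
  haveI : IsManifold I 1 M := IsManifold.of_le (one_le_of_smooth_or_analytic hr)
  ∃ X : (p : M) → TangentSpace I p,
    ContMDiff I I.tangent r (fun p => (⟨p, X p⟩ : TangentBundle I M)) ∧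
    (∀ p, dvec I F p (X p) = ξ p) ∧
    ∀ p : M, ∃ γ : ℝ → M, IsMIntegralCurve γ X ∧ p ∈ range γ ∧
      ∃ a v : Mink n, v ≠ 0 ∧ lorentz v v = 0 ∧
        range (fun t : ℝ => F (γ t)) = range (fun t : ℝ => a + t • v)

end General

/-- `x` is `(f, g)`-related to `y`. -/
def Related {X Y Z : Type*} [TopologicalSpace X] [TopologicalSpace Y]
    (f : X → Z) (g : Y → Z) (x : X) (y : Y) : Prop :=
  ∃ (A : Set X) (B : Set Y), IsOpen A ∧ IsOpen B ∧ x ∈ A ∧ y ∈ B ∧ f x = g y ∧ f '' A = g '' B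

/-- The normal form `(t, x) ↦ (0, g x) + t (1, ν x)` on `ℝ × Σ`. -/
noncomputable def normalForm {n : ℕ} {S : Type*} (g ν : S → Euc n) (z : ℝ × S) : Mink n :=
  ((0 : ℝ), g z.2) + z.1 • ((1 : ℝ), ν z.2)

/-- The vector field `(t, x) ↦ (1, ν x)` along the normal form. -/
def normalFormField {n : ℕ} {S : Type*} (ν : S → Euc n) (z : ℝ × S) : Mink n :=
  ((1 : ℝ), ν z.2)

/-- The open subset `(t₀ - ε, t₀ + ε) × S` of `ℝ × S`, where `ε ∈ [0, ∞]`. -/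
def slab (t₀ : ℝ) (ε : ENNReal) (S : Type*) [TopologicalSpace S] :
    TopologicalSpace.Opens (ℝ × S) where
  carrier := {z | ENNReal.ofReal |z.1 - t₀| < ε}
  is_open' := isOpen_lt
    (ENNReal.continuous_ofReal.comp
      (continuous_abs.comp (continuous_fst.sub continuous_const))) continuous_const

section Adopted

variable {k : ℕ} {M : Type u} [TopologicalSpace M] [ChartedSpace (Euc (k + 1)) M]

/-- Data exhibiting the open set `U` as `F`-adopted. The dimension of `M` is `n = k + 1`, and `ξ`
is the E-normalized normal vector field of `F`. (The identity `F = G_U ∘ Φ_U` on `U` is `g_comp`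
rearranged.) -/
structure AdoptedData (r : WithTop ℕ∞) (F ξ : M → Mink (k + 1))
    (U : TopologicalSpace.Opens M) where
  ε : ENNReal
  ε_pos : 0 < ε
  t₀ : ℝ
  /-- the `(n - 1)`-dimensional `C^r` submanifold `Σ_U` of `U`, with the subspace topology -/
  S : Set M
  S_subset : S ⊆ U
  [charted : ChartedSpace (Euc k) S]
  [manifold : IsManifold 𝓘(ℝ, Euc k) r S]
  incl : IsCrImmersion 𝓘(ℝ, Euc k) 𝓘(ℝ, Euc (k + 1)) r (Subtype.val : S → M)
  /-- the surjective submersion `ρ_U` -/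
  ρ : U → S
  ρ_surjective : Surjective ρ
  ρ_submersion : IsCrSubmersion 𝓘(ℝ, Euc (k + 1)) 𝓘(ℝ, Euc k) r ρ
  /-- the wave front `g_U` -/
  g : S → Euc (k + 1)
  /-- the unit normal vector field `ν_U` of `g_U` -/
  ν : S → Euc (k + 1)
  front : IsFrontWithUnitNormal 𝓘(ℝ, Euc k) r g ν
  ξ_eq : ∀ x : S, ξ (x : M) = ((1 : ℝ), ν x)
  g_comp : ∀ q : U, (((0 : ℝ), g (ρ q)) : Mink (k + 1))
    = F (q : M) - height (F (q : M)) • ξ (ρ q : M)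
  /-- the diffeomorphism `Φ_U = (τ ∘ F, ρ_U)` -/
  Φ : U ≃ₘ^r⟮𝓘(ℝ, Euc (k + 1)), 𝓘(ℝ, ℝ).prod 𝓘(ℝ, Euc k)⟯ slab t₀ ε S
  Φ_apply : ∀ q : U, (Φ q : ℝ × S) = (height (F (q : M)), ρ q)

attribute [instance] AdoptedData.charted AdoptedData.manifold

namespace AdoptedData

variable {r : WithTop ℕ∞} {F ξ : M → Mink (k + 1)} {U : TopologicalSpace.Opens M}

/-- `L_U = (G_U, ξ_U)`, where `G_U(t, x) = (0, g_U x) + t (1, ν_U x)`. -/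
noncomputable def L (D : AdoptedData r F ξ U) : ℝ × D.S → Mink (k + 1) × Mink (k + 1) :=
  legendrianLift (normalForm D.g D.ν) (normalFormField D.ν)

/-- `l_U = (g_U, ν_U)`. -/
def l (D : AdoptedData r F ξ U) : D.S → Euc (k + 1) × Euc (k + 1) := fun x => (D.g x, D.ν x)

/-- The data is strong if `L_U` is an embedding. -/
def Strong (D : AdoptedData r F ξ U) : Prop :=
  IsCrEmbedding (𝓘(ℝ, ℝ).prod 𝓘(ℝ, Euc k)) 𝓘(ℝ, Mink (k + 1) × Mink (k + 1)) r D.L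

/-- `l_U(Σ_U)` is transversal to `l_V(Σ_V)` in `ℝⁿ × Sⁿ⁻¹`: at every common point the two tangent
spaces together span the tangent space `ℝⁿ × ν^⊥` of `ℝⁿ × Sⁿ⁻¹`. -/
def Transversal {V : TopologicalSpace.Opens M} (D : AdoptedData r F ξ U)
    (D' : AdoptedData r F ξ V) : Prop :=
  ∀ (x : D.S) (y : D'.S), D.l x = D'.l y →
    ∀ a b : Euc (k + 1), ⟪b, D.ν x⟫_ℝ = 0 →
      ∃ (v : TangentSpace 𝓘(ℝ, Euc k) x) (w : TangentSpace 𝓘(ℝ, Euc k) y),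
        dvec 𝓘(ℝ, Euc k) D.l x v + dvec 𝓘(ℝ, Euc k) D'.l y w = (a, b)

end AdoptedData

/-- The equivalence relation `p ≈ q` on `M`. -/
def Approx (r : WithTop ℕ∞) (F ξ : M → Mink (k + 1)) (p q : M) : Prop :=
  ∃ (s t : ℝ) (U V : TopologicalSpace.Opens M) (hp : p ∈ U) (hq : q ∈ V)
    (D : AdoptedData r F ξ U) (D' : AdoptedData r F ξ V), D.Strong ∧ D'.Strong ∧
      Related D.L D'.L (s, D.ρ ⟨p, hp⟩) (t, D'.ρ ⟨q, hq⟩)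

/-- Admissibility of the null wave front `F`. -/
def IsAdmissible (r : WithTop ℕ∞) (F ξ : M → Mink (k + 1)) : Prop :=
  ∀ p q : M, Approx r F ξ p q ∨
    ∃ (U V : TopologicalSpace.Opens M) (D : AdoptedData r F ξ U) (D' : AdoptedData r F ξ V),
      p ∈ U ∧ q ∈ V ∧ D.Strong ∧ D'.Strong ∧ D.Transversal D'

end Adopted

end NullFront

/-! Write ξ = (1, ν) and F = (τ, x). Everything is governed by the map l = `lineMap F ξ`, which
sends p to (x - τν, ν): the foot at height 0 and the direction of the light-like line through F(p).
The pair (τ, l) determines L_F, and the L-completion is the space of all lines carried by germs of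
the image of l.

The first point is that dl has a one-dimensional kernel everywhere. The foot point g satisfies ⟪ν,
dg⟫ = 0, and differentiating this shows that ⟪dg u, dν v⟫ is symmetric in u and v. Both dg and dν
map an n-dimensional space into the hyperplane ν^⊥, and `exists_common_kernel` turns symmetry and
this dimension count into a common kernel vector. Rescaled, it is a vector X with dF(X) = (1, ν) and
dν(X) = 0 (`IsNullFront.tangent_and_immersion`). Since (τ, l) is an immersion, ker dl is spanned by
X. Hence `exists_flowBox`: near each point there is a chart (τ, P ∘ l) with P linear, onto an
interval times an open set, in which l depends on P ∘ l only.

Two points are identified when l takes the same value there and pushes their neighbourhood filters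
to the same filter, that is, when the images have the same germ. On a flow box this germ depends
only on the value of l, so P ∘ l descends to a chart of the quotient `GermSpace`, the projection is
open, and τ together with the projection is a local diffeomorphism. The analyticity or admissibility
hypothesis serves only to make the quotient Hausdorff (`GermSpace.t2Space`). In the analytic case
this is the identity theorem. In the admissible case transversality is disjointness, because two
k-dimensional tangent spaces cannot span a space of dimension 2k + 1, so equal lines already have
equal germs.

Finally `approx_iff_sameGerm` identifies ≈ with equality of germs: flow boxes are strongly adopted,
and for every adopted set the map l_U ∘ ρ_U is the restriction of l. The assertions about G are
computations with the normal form. -/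

namespace NullFront

/-! ### Differentials of maps with a local one-sided inverse -/

section Derivatives

variable {E H M : Type*} [NormedAddCommGroup E] [NormedSpace ℝ E] [TopologicalSpace H]
  {I : ModelWithCorners ℝ E H} [TopologicalSpace M] [ChartedSpace H M]
variable {E' H' N : Type*} [NormedAddCommGroup E'] [NormedSpace ℝ E'] [TopologicalSpace H']
  {J : ModelWithCorners ℝ E' H'} [TopologicalSpace N] [ChartedSpace H' N]

theorem mfderiv_injective_of_leftInverse {f : M → N} {g : N → M} {x : M}
    (hf : MDifferentiableAt I J f x) (hg : MDifferentiableAt J I g (f x))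
    (h : g ∘ f =ᶠ[nhds x] id) : Injective (mfderiv I J f x) := by
  have h1 : mfderiv I I (g ∘ f) x = (mfderiv J I g (f x)).comp (mfderiv I J f x) :=
    mfderiv_comp x hg hf
  have h2 : mfderiv I I (g ∘ f) x = mfderiv I I id x := h.mfderiv_eq
  rw [h2, mfderiv_id] at h1
  intro v w hvw
  have hv := congrArg (fun A : E →L[ℝ] E => A v) h1
  have hw := congrArg (fun A : E →L[ℝ] E => A w) h1
  have e1 : v = mfderiv J I g (f x) (mfderiv I J f x v) := hv
  have e2 : w = mfderiv J I g (f x) (mfderiv I J f x w) := hw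
  rw [e1, e2, hvw]

theorem mfderiv_surjective_of_rightInverse {f : M → N} {g : N → M} {x : M} {y : N}
    (hxy : g y = x) (hf : MDifferentiableAt I J f x) (hg : MDifferentiableAt J I g y)
    (h : f ∘ g =ᶠ[nhds y] id) : Surjective (mfderiv I J f x) := by
  subst hxy
  have h1 : mfderiv J J (f ∘ g) y = (mfderiv I J f (g y)).comp (mfderiv J I g y) :=
    mfderiv_comp y hf hg
  have h2 : mfderiv J J (f ∘ g) y = mfderiv J J id y := h.mfderiv_eq
  rw [h2, mfderiv_id] at h1
  intro v
  exact ⟨mfderiv J I g y v, (congrArg (fun A : E' →L[ℝ] E' => A v) h1).symm⟩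

end Derivatives

/-! ### Linear algebra: common kernels and projections -/

section LinearAlgebra

/-- Linear maps `C`, `B` into the hyperplane `ν^⊥` with `⟪C u, B v⟫` symmetric have a common kernel
vector as soon as the dimension of the source is that of the ambient space. -/
theorem exists_common_kernel {T W : Type*} [AddCommGroup T] [Module ℝ T] [FiniteDimensional ℝ T]
    [NormedAddCommGroup W] [InnerProductSpace ℝ W] [FiniteDimensional ℝ W]
    (hdim : Module.finrank ℝ T = Module.finrank ℝ W) (C B : T →ₗ[ℝ] W) (ν : W) (hν : ν ≠ 0)
    (hC : ∀ v, ⟪ν, C v⟫_ℝ = 0) (hB : ∀ v, ⟪ν, B v⟫_ℝ = 0)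
    (hsymm : ∀ u v, ⟪C u, B v⟫_ℝ = ⟪C v, B u⟫_ℝ) : ∃ X : T, X ≠ 0 ∧ C X = 0 ∧ B X = 0 := by
  by_contra! hcon
  -- This is C + iB on the complexification, applied to u + iv, with the complex line of ν added to
  -- the target directions. If C and B had no common kernel vector it would be injective: Cu = Bv
  -- and Cv = -Bu give |Cu|² = ⟪Cu, Bv⟫ = ⟪Cv, Bu⟫ = -|Bu|², so everything vanishes. But the source
  -- has real dimension 2n + 2 and the target 2n.
  let A : (T × T) × (ℝ × ℝ) →ₗ[ℝ] W × W :=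
    { toFun := fun z => (C z.1.1 - B z.1.2 + z.2.1 • ν, B z.1.1 + C z.1.2 + z.2.2 • ν)
      map_add' := by
        intro x y
        simp only [Prod.fst_add, Prod.snd_add, map_add, add_smul, Prod.mk_add_mk, Prod.mk.injEq]
        constructor <;> abel
      map_smul' := by
        intro c x
        simp only [Prod.smul_fst, Prod.smul_snd, map_smul, RingHom.id_apply, Prod.smul_mk,
          smul_add, smul_sub, smul_assoc] }
  have key : Injective A := by
    rw [← LinearMap.ker_eq_bot, LinearMap.ker_eq_bot']
    rintro ⟨⟨u, v⟩, a, b⟩ hz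
    have h1 : C u - B v + a • ν = 0 := congrArg Prod.fst hz
    have h2 : B u + C v + b • ν = 0 := congrArg Prod.snd hz
    have ha : a = 0 := by
      have := congrArg (fun w => ⟪ν, w⟫_ℝ) h1
      simp only [inner_add_right, inner_sub_right, hC, hB, inner_smul_right, inner_zero_right,
        sub_zero, zero_add] at this
      exact (mul_eq_zero.1 this).resolve_right (inner_self_ne_zero.2 hν)
    have hb : b = 0 := by
      have := congrArg (fun w => ⟪ν, w⟫_ℝ) h2
      simp only [inner_add_right, hC, hB, inner_smul_right, inner_zero_right, zero_add] at this
      exact (mul_eq_zero.1 this).resolve_right (inner_self_ne_zero.2 hν)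
    subst ha hb
    rw [zero_smul, add_zero] at h1 h2
    have e1 : ⟪C u, C u⟫_ℝ = ⟪C u, B v⟫_ℝ := by rw [sub_eq_zero.1 h1]
    have e2 : ⟪B v, B v⟫_ℝ = ⟪C u, B v⟫_ℝ := by rw [sub_eq_zero.1 h1]
    have h2' : C v = - B u := by rw [eq_neg_iff_add_eq_zero, add_comm, h2]
    have e3 : ⟪C v, B u⟫_ℝ = - ⟪B u, B u⟫_ℝ := by rw [h2', inner_neg_left]
    have e4 : ⟪C v, B u⟫_ℝ = - ⟪C v, C v⟫_ℝ := by
      rw [h2', inner_neg_left, inner_neg_neg]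
    have hs := hsymm u v
    have p1 : 0 ≤ ⟪C u, C u⟫_ℝ := real_inner_self_nonneg
    have p2 : 0 ≤ ⟪B v, B v⟫_ℝ := real_inner_self_nonneg
    have p3 : 0 ≤ ⟪B u, B u⟫_ℝ := real_inner_self_nonneg
    have p4 : 0 ≤ ⟪C v, C v⟫_ℝ := real_inner_self_nonneg
    have q1 : C u = 0 := inner_self_eq_zero.1 (by linarith : ⟪C u, C u⟫_ℝ = 0)
    have q2 : B v = 0 := inner_self_eq_zero.1 (by linarith : ⟪B v, B v⟫_ℝ = 0)
    have q3 : B u = 0 := inner_self_eq_zero.1 (by linarith : ⟪B u, B u⟫_ℝ = 0)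
    have q4 : C v = 0 := inner_self_eq_zero.1 (by linarith : ⟪C v, C v⟫_ℝ = 0)
    have hu : u = 0 := by by_contra hu; exact hcon u hu q1 q3
    have hv : v = 0 := by by_contra hv; exact hcon v hv q4 q2
    rw [hu, hv]; rfl
  have := LinearMap.finrank_le_finrank_of_injective key
  simp only [Module.finrank_prod, Module.finrank_self] at this
  omega

/-- If `(τ, l)` is injective and some vector lies in `ker l` but not in `ker τ`, then `l` can be
followed by a linear map `P` to a space of dimension `dim E - 1` such that `(τ, P ∘ l)` is still
injective. -/
theorem exists_projection_injective {E V K : Type*} [AddCommGroup E] [Module ℝ E]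
    [FiniteDimensional ℝ E]
    [NormedAddCommGroup V] [NormedSpace ℝ V] [FiniteDimensional ℝ V]
    [NormedAddCommGroup K] [NormedSpace ℝ K] [FiniteDimensional ℝ K]
    (hdim : Module.finrank ℝ E = Module.finrank ℝ K + 1)
    (τ : E →ₗ[ℝ] ℝ) (l : E →ₗ[ℝ] V) (hinj : ∀ v, τ v = 0 → l v = 0 → v = 0)
    (X : E) (hX : τ X = 1) (hX' : l X = 0) :
    ∃ P : V →L[ℝ] K, ∀ v, P (l v) = 0 → l v = 0 := by
  have hker : LinearMap.ker l = Submodule.span ℝ {X} := by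
    apply le_antisymm
    · intro v hv
      rw [Submodule.mem_span_singleton]
      refine ⟨τ v, ?_⟩
      have := hinj (v - τ v • X) (by simp [hX]) (by simp [hX', LinearMap.mem_ker.1 hv])
      exact (sub_eq_zero.1 this).symm
    · rw [Submodule.span_singleton_le_iff_mem]; exact hX'
  have hX0 : X ≠ 0 := by rintro rfl; simp at hX
  have h1 := LinearMap.finrank_range_add_finrank_ker l
  rw [hker, finrank_span_singleton hX0] at h1
  have h2 : Module.finrank ℝ (LinearMap.range l) = Module.finrank ℝ K := by omega
  -- The kernel of `l` is the line of `X`, so its range has the dimension of `K`. Any isomorphism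
  -- from the range to `K`, extended linearly to `V`, will do.
  let e := LinearEquiv.ofFinrankEq _ _ h2
  obtain ⟨P, hP⟩ := LinearMap.exists_extend (e : LinearMap.range l →ₗ[ℝ] K)
  refine ⟨LinearMap.toContinuousLinearMap P, fun v hv => ?_⟩
  have h3 : P (l v) = e ⟨l v, LinearMap.mem_range_self l v⟩ := by
    have := LinearMap.congr_fun hP ⟨l v, LinearMap.mem_range_self l v⟩
    simpa using this
  have h4 : e ⟨l v, LinearMap.mem_range_self l v⟩ = 0 := by rw [← h3]; exact hv
  exact congrArg Subtype.val (e.map_eq_zero_iff.1 h4)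

end LinearAlgebra

/-! ### Symmetry of ⟪dg, dν⟫ -/

section SymmetricSecondDerivative

/-- If `⟪ν, dg⟫ = 0` near `x`, then `⟪dg u, dν v⟫` is symmetric in `u`, `v` at `x`. -/
theorem inner_fderiv_symm {E W : Type*} [NormedAddCommGroup E] [NormedSpace ℝ E]
    [NormedAddCommGroup W] [InnerProductSpace ℝ W] {g ν : E → W} {x : E}
    (hg : ContDiffAt ℝ 2 g x) (hν : DifferentiableAt ℝ ν x)
    (h : ∀ᶠ y in nhds x, ∀ v, ⟪ν y, fderiv ℝ g y v⟫_ℝ = 0) (u v : E) :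
    ⟪fderiv ℝ g x u, fderiv ℝ ν x v⟫_ℝ = ⟪fderiv ℝ g x v, fderiv ℝ ν x u⟫_ℝ := by
  have hs : IsSymmSndFDerivAt ℝ g x := hg.isSymmSndFDerivAt (by simp)
  have hd : DifferentiableAt ℝ (fderiv ℝ g) x :=
    (hg.fderiv_right (m := 1) (by norm_num)).differentiableAt (by norm_num)
  -- Differentiate ⟪ν, dg b⟫ = 0 in the direction a. The term with the second derivative of g is
  -- symmetric in a and b, hence so is the other one.
  have key : ∀ a b : E, ⟪ν x, fderiv ℝ (fderiv ℝ g) x a b⟫_ℝ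
      + ⟪fderiv ℝ ν x a, fderiv ℝ g x b⟫_ℝ = 0 := by
    intro a b
    have hdb : HasFDerivAt (fun y => fderiv ℝ g y b) ((fderiv ℝ (fderiv ℝ g) x).flip b) x := by
      have := hd.hasFDerivAt.clm_apply (hasFDerivAt_const b x)
      simpa using this
    have h1 := hν.hasFDerivAt.inner ℝ hdb
    have h2 : (fun y => ⟪ν y, fderiv ℝ g y b⟫_ℝ) =ᶠ[nhds x] fun _ => (0 : ℝ) :=
      h.mono fun y hy => hy b
    have h3 := h1.unique (h2.hasFDerivAt_iff.2 (hasFDerivAt_const (0 : ℝ) x))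
    have h4 := congrArg (fun A : E →L[ℝ] ℝ => A a) h3
    simpa [fderivInnerCLM_apply] using h4
  have k1 := key u v
  have k2 := key v u
  rw [hs.eq u v] at k1
  rw [real_inner_comm, real_inner_comm (fderiv ℝ ν x u)]
  linarith

end SymmetricSecondDerivative

/-! ### Flow boxes -/

section FlowBoxEuclidean

variable {E V K : Type*} [NormedAddCommGroup E] [NormedSpace ℝ E] [FiniteDimensional ℝ E]
  [NormedAddCommGroup V] [NormedSpace ℝ V] [FiniteDimensional ℝ V]
  [NormedAddCommGroup K] [NormedSpace ℝ K] [FiniteDimensional ℝ K]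

/-- The inverse function theorem applied to (τ, P ∘ l), where P is chosen so that this map has
invertible differential at x₀. In the resulting coordinates the vector X of `hX` is the coordinate
field of the first factor. It is killed by dl, so l is constant along the intervals of the box. -/
theorem exists_flowBox_euclidean (hdim : Module.finrank ℝ E = Module.finrank ℝ K + 1)
    {r : WithTop ℕ∞} (hr : 1 ≤ r) {U : Set E} (hU : IsOpen U) {τ : E → ℝ} {l : E → V}
    (hτ : ContDiffOn ℝ r τ U) (hl : ContDiffOn ℝ r l U)
    (hX : ∀ x ∈ U, ∃ X, fderiv ℝ τ x X = 1 ∧ fderiv ℝ l x X = 0)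
    (hinj : ∀ x ∈ U, ∀ v, fderiv ℝ τ x v = 0 → fderiv ℝ l x v = 0 → v = 0)
    {x₀ : E} (hx₀ : x₀ ∈ U) :
    ∃ (e : OpenPartialHomeomorph E (ℝ × K)) (P : V →L[ℝ] K) (ε : ℝ) (B : Set K), 0 < ε ∧
      IsOpen B ∧ x₀ ∈ e.source ∧ e.source ⊆ U ∧
      e.target = Ioo (τ x₀ - ε) (τ x₀ + ε) ×ˢ B ∧
      (∀ x ∈ e.source, e x = (τ x, P (l x))) ∧ ContDiffOn ℝ r e.symm e.target ∧
      ∀ x ∈ e.source, ∀ y ∈ e.source, P (l x) = P (l y) → l x = l y := by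
  have hr0 : r ≠ 0 := (zero_lt_one.trans_le hr).ne'
  have dτ : ∀ x ∈ U, HasFDerivAt τ (fderiv ℝ τ x) x := fun x hx =>
    ((hτ.contDiffAt (hU.mem_nhds hx)).differentiableAt hr0).hasFDerivAt
  have dl : ∀ x ∈ U, HasFDerivAt l (fderiv ℝ l x) x := fun x hx =>
    ((hl.contDiffAt (hU.mem_nhds hx)).differentiableAt hr0).hasFDerivAt
  obtain ⟨P, hP⟩ : ∃ P : V →L[ℝ] K, ∀ v, P (fderiv ℝ l x₀ v) = 0 → fderiv ℝ l x₀ v = 0 := by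
    obtain ⟨X, h1, h2⟩ := hX x₀ hx₀
    exact exists_projection_injective hdim (fderiv ℝ τ x₀).toLinearMap (fderiv ℝ l x₀).toLinearMap
      (hinj x₀ hx₀) X h1 h2
  set f : E → ℝ × K := fun x => (τ x, P (l x)) with hf
  have hfU : ContDiffOn ℝ r f U := hτ.prodMk (P.contDiff.comp_contDiffOn hl)
  have df : ∀ x ∈ U, HasFDerivAt f ((fderiv ℝ τ x).prod (P.comp (fderiv ℝ l x))) x := fun x hx =>
    (dτ x hx).prodMk (P.hasFDerivAt.comp x (dl x hx))
  have hfat : ContDiffAt ℝ r f x₀ := hfU.contDiffAt (hU.mem_nhds hx₀)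
  have hA : Injective ((fderiv ℝ τ x₀).prod (P.comp (fderiv ℝ l x₀))) := by
    rw [injective_iff_map_eq_zero]
    intro v hv
    exact hinj x₀ hx₀ v (congrArg Prod.fst hv) (hP v (congrArg Prod.snd hv))
  have hdim' : Module.finrank ℝ E = Module.finrank ℝ (ℝ × K) := by
    rw [Module.finrank_prod, Module.finrank_self, hdim, add_comm]
  let A : E ≃L[ℝ] ℝ × K := (LinearEquiv.ofInjectiveOfFinrankEq
    ((fderiv ℝ τ x₀).prod (P.comp (fderiv ℝ l x₀))).toLinearMap hA hdim').toContinuousLinearEquiv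
  have hAeq : (A : E →L[ℝ] ℝ × K) = fderiv ℝ f x₀ := by
    rw [(df x₀ hx₀).fderiv]
    ext v <;> rfl
  have hfA : HasFDerivAt f (A : E →L[ℝ] ℝ × K) x₀ := by
    rw [hAeq]; exact (hfat.differentiableAt hr0).hasFDerivAt
  let e₀ := hfat.toOpenPartialHomeomorph f hfA hr0
  -- The differential must be invertible at every point of the box, not just at x₀: this gives
  -- regularity of the inverse throughout, and it makes the vector X unique there.
  let W : Set E := U ∩ fderiv ℝ f ⁻¹' range ((↑) : (E ≃L[ℝ] ℝ × K) → E →L[ℝ] ℝ × K)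
  have hW : IsOpen W :=
    (hfU.continuousOn_fderiv_of_isOpen hU hr).isOpen_inter_preimage hU
      ContinuousLinearEquiv.isOpen
  have hx₀W : x₀ ∈ W := ⟨hx₀, A, hAeq⟩
  have hx₀e : x₀ ∈ e₀.source := hfat.mem_toOpenPartialHomeomorph_source hfA hr0
  obtain ⟨ε, hε, hball⟩ : ∃ ε > 0, Metric.ball (e₀ x₀) ε ⊆ e₀.target ∩ e₀.symm ⁻¹' W :=
    Metric.isOpen_iff.1 (e₀.isOpen_inter_preimage_symm hW) _
      ⟨e₀.map_source hx₀e, by rw [mem_preimage, e₀.left_inv hx₀e]; exact hx₀W⟩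
  -- A ball for the sup metric of ℝ × K, hence an interval times a ball.
  let Q := Metric.ball (e₀ x₀) ε
  have hQ : Q = Ioo (τ x₀ - ε) (τ x₀ + ε) ×ˢ Metric.ball (P (l x₀)) ε := by
    rw [← Real.ball_eq_Ioo, ball_prod_same]; rfl
  have hQo : IsOpen Q := Metric.isOpen_ball
  let e := (e₀.symm.restrOpen Q hQo).symm
  have het : e.target = Q := inter_eq_right.2 fun z hz => (hball hz).1
  have hes : ∀ z, e.symm z = e₀.symm z := fun z => rfl
  have hsymmW : ∀ z ∈ Q, e.symm z ∈ W := fun z hz => (hball hz).2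
  have hsrc : e.source ⊆ W := by
    intro x hx
    have := hsymmW (e x) (het ▸ e.map_source hx)
    rwa [e.left_inv hx] at this
  have hsymm : ∀ z ∈ Q, ContDiffAt ℝ r e.symm z := by
    intro z hz
    obtain ⟨hzU, A', hA'⟩ := hsymmW z hz
    refine e.contDiffAt_symm (het ▸ hz) (f₀' := A') ?_ (hfU.contDiffAt (hU.mem_nhds hzU))
    rw [hA']
    exact ((hfU.contDiffAt (hU.mem_nhds hzU)).differentiableAt hr0).hasFDerivAt
  -- The t-derivative of the inverse chart and the vector X have the same image (1, 0) under df, so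
  -- they coincide, and dl kills both.
  have hconst : ∀ (t t' : ℝ) (y : K), (t, y) ∈ Q → (t', y) ∈ Q →
      l (e.symm (t, y)) = l (e.symm (t', y)) := by
    intro t t' y ht ht'
    rw [hQ] at ht ht'
    have hder : ∀ s ∈ Ioo (τ x₀ - ε) (τ x₀ + ε),
        HasDerivAt (fun s => l (e.symm (s, y))) 0 s := by
      intro s hs
      have hz : (s, y) ∈ Q := by rw [hQ]; exact ⟨hs, ht.2⟩
      obtain ⟨hzU, A', hA'⟩ := hsymmW _ hz
      have d1 : HasFDerivAt e.symm (fderiv ℝ e.symm (s, y)) (s, y) :=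
        ((hsymm _ hz).differentiableAt hr0).hasFDerivAt
      set w := fderiv ℝ e.symm (s, y) (1, 0) with hw
      have d2 : HasDerivAt (fun s : ℝ => e.symm (s, y)) w s :=
        d1.comp_hasDerivAt s ((hasDerivAt_id s).prodMk (hasDerivAt_const s y))
      have d3 := (dl _ hzU).comp_hasDerivAt s d2
      have d4 := (df _ hzU).comp_hasDerivAt s d2
      have hev : (fun s : ℝ => f (e.symm (s, y))) =ᶠ[nhds s] fun s => (s, y) := by
        have : ∀ᶠ s' in nhds s, s' ∈ Ioo (τ x₀ - ε) (τ x₀ + ε) := isOpen_Ioo.mem_nhds hs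
        filter_upwards [this] with s' hs'
        exact e.right_inv (het ▸ hQ ▸ ⟨hs', ht.2⟩)
      have d5 : HasDerivAt (fun s : ℝ => f (e.symm (s, y))) ((1 : ℝ), (0 : K)) s :=
        ((hasDerivAt_id s).prodMk (hasDerivAt_const s y)).congr_of_eventuallyEq hev
      have d6 := d4.unique d5
      obtain ⟨X, hX1, hX2⟩ := hX _ hzU
      have hwX : w = X := by
        apply A'.injective
        have k1 : A' w = (1, 0) := by
          rw [← d6, ← (df _ hzU).fderiv, ← hA']; rfl
        have k2 : A' X = (1, 0) := by
          have : A' X = (A' : E →L[ℝ] ℝ × K) X := rfl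
          rw [this, hA', (df _ hzU).fderiv]
          simp [hX1, hX2]
        rw [k1, k2]
      rw [hwX, hX2] at d3
      exact d3
    refine isOpen_Ioo.is_const_of_deriv_eq_zero isPreconnected_Ioo
      (fun s hs => (hder s hs).differentiableAt.differentiableWithinAt)
      (fun s hs => (hder s hs).deriv) ht.1 ht'.1
  refine ⟨e, P, ε, Metric.ball (P (l x₀)) ε, hε, Metric.isOpen_ball, ?_, fun x hx => (hsrc hx).1,
    het.trans hQ, fun x _ => rfl, fun z hz => (hsymm z (het ▸ hz)).contDiffWithinAt, ?_⟩
  · have : e.symm (e₀ x₀) ∈ e.source := e.map_target (het ▸ Metric.mem_ball_self hε)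
    rwa [hes, e₀.left_inv hx₀e] at this
  · intro x hx y hy hxy
    have h1 : (τ x, P (l x)) ∈ Q := het ▸ e.map_source hx
    have h2 : (τ y, P (l x)) ∈ Q := by rw [hxy]; exact het ▸ e.map_source hy
    have h3 := hconst _ _ _ h1 h2
    have h4 : e.symm (τ x, P (l x)) = x := e.left_inv hx
    have h5 : e.symm (τ y, P (l x)) = y := by rw [hxy]; exact e.left_inv hy
    rwa [h4, h5] at h3

end FlowBoxEuclidean

section FlowBox

variable {E V : Type*} [NormedAddCommGroup E] [NormedSpace ℝ E]
  [NormedAddCommGroup V] [NormedSpace ℝ V]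
  {M : Type*} [TopologicalSpace M] [ChartedSpace E M]

variable (E) in
/-- A chart of the form `(τ, P ∘ l)` onto a product of an interval with an open set, on which `l` is
a function of `P ∘ l`. -/
structure FlowBox (K : Type*) [NormedAddCommGroup K] [NormedSpace ℝ K] (r : WithTop ℕ∞)
    (τ : M → ℝ) (l : M → V) where
  e : OpenPartialHomeomorph M (ℝ × K)
  P : V →L[ℝ] K
  t₀ : ℝ
  ε : ℝ
  ε_pos : 0 < ε
  B : Set K
  isOpen_B : IsOpen B
  target_eq : e.target = Ioo (t₀ - ε) (t₀ + ε) ×ˢ B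
  apply_eq : ∀ x ∈ e.source, e x = (τ x, P (l x))
  contMDiffOn_symm : ContMDiffOn 𝓘(ℝ, ℝ × K) 𝓘(ℝ, E) r e.symm e.target
  eq_of_proj_eq : ∀ x ∈ e.source, ∀ y ∈ e.source, P (l x) = P (l y) → l x = l y

theorem fderiv_comp_chart {f : M → V} (hf : MDifferentiable 𝓘(ℝ, E) 𝓘(ℝ, V) f) {s : E → M} {x : E}
    (hs : MDifferentiableAt 𝓘(ℝ, E) 𝓘(ℝ, E) s x) (v : E) :
    fderiv ℝ (f ∘ s) x v = dvec 𝓘(ℝ, E) f (s x) (mfderiv 𝓘(ℝ, E) 𝓘(ℝ, E) s x v) := by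
  rw [← mfderiv_eq_fderiv, mfderiv_comp x (hf _) hs]
  rfl

theorem exists_flowBox {K : Type*} [NormedAddCommGroup K] [NormedSpace ℝ K]
    [FiniteDimensional ℝ E] [FiniteDimensional ℝ V] [FiniteDimensional ℝ K]
    (hdim : Module.finrank ℝ E = Module.finrank ℝ K + 1)
    {r : WithTop ℕ∞} (hr : 1 ≤ r) [IsManifold 𝓘(ℝ, E) r M] {τ : M → ℝ} {l : M → V}
    (hτ : ContMDiff 𝓘(ℝ, E) 𝓘(ℝ, ℝ) r τ) (hl : ContMDiff 𝓘(ℝ, E) 𝓘(ℝ, V) r l)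
    (hX : ∀ p, ∃ X : TangentSpace 𝓘(ℝ, E) p,
      dvec 𝓘(ℝ, E) τ p X = 1 ∧ dvec 𝓘(ℝ, E) l p X = 0)
    (hinj : ∀ (p : M) (v : TangentSpace 𝓘(ℝ, E) p),
      dvec 𝓘(ℝ, E) τ p v = 0 → dvec 𝓘(ℝ, E) l p v = 0 → v = 0) (p : M) :
    ∃ b : FlowBox E K r τ l, p ∈ b.e.source := by
  have hr0 : r ≠ 0 := (zero_lt_one.trans_le hr).ne'
  let φ := chartAt E p
  have : IsManifold 𝓘(ℝ, E) 1 M := IsManifold.of_le hr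
  have hφ : φ ∈ IsManifold.maximalAtlas 𝓘(ℝ, E) r M := IsManifold.chart_mem_maximalAtlas (I := 𝓘(ℝ, E)) (n := r) p
  have hφs : ContMDiffOn 𝓘(ℝ, E) 𝓘(ℝ, E) r φ.symm φ.target :=
    contMDiffOn_symm_of_mem_maximalAtlas hφ
  have hφd : ∀ x ∈ φ.target, MDifferentiableAt 𝓘(ℝ, E) 𝓘(ℝ, E) φ.symm x := fun x hx =>
    ((hφs x hx).contMDiffAt (φ.open_target.mem_nhds hx)).mdifferentiableAt hr0
  have hφd' : ∀ y : M, y ∈ φ.source → MDifferentiableAt 𝓘(ℝ, E) 𝓘(ℝ, E) φ y := fun y hy =>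
    (((contMDiffOn_of_mem_maximalAtlas hφ) y hy).contMDiffAt
      (φ.open_source.mem_nhds hy)).mdifferentiableAt hr0
  have inj : ∀ x ∈ φ.target, Injective (mfderiv 𝓘(ℝ, E) 𝓘(ℝ, E) φ.symm x) := fun x hx =>
    mfderiv_injective_of_leftInverse (g := φ) (hφd x hx) (hφd' _ (φ.map_target hx))
      (φ.eventually_right_inverse hx)
  have surj : ∀ x ∈ φ.target, Surjective (mfderiv 𝓘(ℝ, E) 𝓘(ℝ, E) φ.symm x) := fun x hx =>
    mfderiv_surjective_of_rightInverse (g := φ) (y := φ.symm x) (φ.right_inv hx) (hφd x hx)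
      (hφd' _ (φ.map_target hx)) (φ.eventually_left_inverse (φ.map_target hx))
  obtain ⟨e, P, ε, B, hε, hB, he1, he2, he3, he4, he5, he6⟩ :=
    exists_flowBox_euclidean (K := K) hdim hr φ.open_target 
      (contMDiffOn_iff_contDiffOn.1 (hτ.comp_contMDiffOn hφs))
      (contMDiffOn_iff_contDiffOn.1 (hl.comp_contMDiffOn hφs))
      (fun x hx => by
        obtain ⟨X, h1, h2⟩ := hX (φ.symm x)
        obtain ⟨Y, rfl⟩ := surj x hx X
        exact ⟨Y, (fderiv_comp_chart (hτ.mdifferentiable hr0) (hφd x hx) Y).trans h1, (fderiv_comp_chart (hl.mdifferentiable hr0) (hφd x hx) Y).trans h2⟩)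
      (fun x hx v h1 h2 => by
        have h3 := hinj (φ.symm x) _ ((fderiv_comp_chart (hτ.mdifferentiable hr0) (hφd x hx) v).symm.trans h1) ((fderiv_comp_chart (hl.mdifferentiable hr0) (hφd x hx) v).symm.trans h2)
        exact inj x hx (h3.trans (map_zero (mfderiv 𝓘(ℝ, E) 𝓘(ℝ, E) φ.symm x)).symm))
      (x₀ := φ p) (φ.map_source (mem_chart_source E p))
  have htgt : (φ.trans e).target = e.target := by
    ext z
    simp only [OpenPartialHomeomorph.trans_target, mem_inter_iff, mem_preimage]
    exact ⟨fun h => h.1, fun h => ⟨h, he2 (e.map_target h)⟩⟩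
  refine ⟨⟨φ.trans e, P, (τ ∘ φ.symm) (φ p), ε, hε, B, hB, htgt.trans he3, ?_, ?_, ?_⟩, ?_⟩
  · intro x hx
    have := he4 (φ x) hx.2
    simp only [comp_apply, φ.left_inv hx.1] at this
    exact this
  · rw [htgt]
    exact hφs.comp (contMDiffOn_iff_contDiffOn.2 he5) fun z hz => he2 (e.map_target hz)
  · intro x hx y hy hxy
    have := he6 (φ x) hx.2 (φ y) hy.2
    simp only [comp_apply, φ.left_inv hx.1, φ.left_inv hy.1] at this
    exact this hxy
  · exact ⟨mem_chart_source E p, he1⟩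

end FlowBox

/-! ### The space of germs of images -/

section GermSpaceTopology

open Filter Topology

variable {M V : Type*} [TopologicalSpace M] {l : M → V}

/-- `l` has the same value and the same germ of image at `p` and `q`. -/
def SameGerm (l : M → V) (p q : M) : Prop := l p = l q ∧ map l (𝓝 p) = map l (𝓝 q)

/-- The equivalence relation of having the same germ of image. -/
def germSetoid (l : M → V) : Setoid M where
  r := SameGerm l
  iseqv := ⟨fun _ => ⟨rfl, rfl⟩, fun h => ⟨h.1.symm, h.2.symm⟩,
    fun h h' => ⟨h.1.trans h'.1, h.2.trans h'.2⟩⟩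

/-- The space of germs of images of `l`. -/
def GermSpace (l : M → V) : Type _ := Quotient (germSetoid l)

namespace GermSpace

instance : TopologicalSpace (GermSpace l) := inferInstanceAs (TopologicalSpace (Quotient _))

/-- The projection to the space of germs. -/
def mk (l : M → V) (p : M) : GermSpace l := Quotient.mk (germSetoid l) p

/-- The map induced by `l` on the space of germs. -/
def lift (s : GermSpace l) : V := Quotient.lift l (fun _ _ (h : SameGerm l _ _) => h.1) s

theorem mk_eq_mk {p q : M} : mk l p = mk l q ↔ SameGerm l p q := Quotient.eq (r := germSetoid l)

theorem mk_surjective : Surjective (mk l) := Quotient.mk_surjective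

theorem continuous_mk : Continuous (mk l) := continuous_quotient_mk'

theorem continuous_lift [TopologicalSpace V] (hl : Continuous l) : Continuous (lift : GermSpace l → V) :=
  hl.quotient_lift _

end GermSpace

end GermSpaceTopology

section Germs

open Filter Topology

variable {E V K : Type*} [NormedAddCommGroup E] [NormedSpace ℝ E]
  [NormedAddCommGroup V] [NormedSpace ℝ V] [NormedAddCommGroup K] [NormedSpace ℝ K]
  {M : Type*} [TopologicalSpace M] [ChartedSpace E M] {r : WithTop ℕ∞} {τ : M → ℝ} {l : M → V}

namespace FlowBox

variable (b : FlowBox E K r τ l)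

/-- `l` as a function of `P ∘ l`. -/
def param (y : K) : V := l (b.e.symm (b.t₀, y))

variable {b}

theorem mem_target {t : ℝ} {y : K} : (t, y) ∈ b.e.target ↔ t ∈ Ioo (b.t₀ - b.ε) (b.t₀ + b.ε) ∧
    y ∈ b.B := by
  rw [b.target_eq]; rfl

theorem t₀_mem : b.t₀ ∈ Ioo (b.t₀ - b.ε) (b.t₀ + b.ε) := by
  constructor <;> linarith [b.ε_pos]

theorem t₀_mem_target {y : K} (hy : y ∈ b.B) : (b.t₀, y) ∈ b.e.target :=
  mem_target.2 ⟨t₀_mem, hy⟩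

theorem coords_mem_target {x : M} (hx : x ∈ b.e.source) : (τ x, b.P (l x)) ∈ b.e.target := by
  rw [← b.apply_eq x hx]; exact b.e.map_source hx

theorem τ_mem {x : M} (hx : x ∈ b.e.source) : τ x ∈ Ioo (b.t₀ - b.ε) (b.t₀ + b.ε) :=
  (mem_target.1 (coords_mem_target hx)).1

theorem proj_mem {x : M} (hx : x ∈ b.e.source) : b.P (l x) ∈ b.B :=
  (mem_target.1 (coords_mem_target hx)).2

theorem symm_coords {x : M} (hx : x ∈ b.e.source) : b.e.symm (τ x, b.P (l x)) = x := by
  rw [← b.apply_eq x hx, b.e.left_inv hx]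

theorem coords_symm {t : ℝ} {y : K} (h : (t, y) ∈ b.e.target) :
    (τ (b.e.symm (t, y)), b.P (l (b.e.symm (t, y)))) = (t, y) := by
  rw [← b.apply_eq _ (b.e.map_target h), b.e.right_inv h]

theorem τ_symm {t : ℝ} {y : K} (h : (t, y) ∈ b.e.target) : τ (b.e.symm (t, y)) = t :=
  congrArg Prod.fst (coords_symm h)

theorem proj_symm {t : ℝ} {y : K} (h : (t, y) ∈ b.e.target) : b.P (l (b.e.symm (t, y))) = y :=
  congrArg Prod.snd (coords_symm h)

theorem proj_param {y : K} (hy : y ∈ b.B) : b.P (b.param y) = y := proj_symm (t₀_mem_target hy)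

theorem l_symm {t : ℝ} {y : K} (h : (t, y) ∈ b.e.target) : l (b.e.symm (t, y)) = b.param y := by
  have hy := (mem_target.1 h).2
  refine b.eq_of_proj_eq _ (b.e.map_target h) _ (b.e.map_target (t₀_mem_target hy)) ?_
  rw [proj_symm h, proj_symm (t₀_mem_target hy)]

theorem param_proj {x : M} (hx : x ∈ b.e.source) : b.param (b.P (l x)) = l x := by
  rw [← l_symm (coords_mem_target hx), symm_coords hx]

theorem contDiffOn_param (hl : ContMDiff 𝓘(ℝ, E) 𝓘(ℝ, V) r l) : ContDiffOn ℝ r b.param b.B := by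
  rw [← contMDiffOn_iff_contDiffOn]
  refine hl.comp_contMDiffOn (b.contMDiffOn_symm.comp ?_ fun y hy => t₀_mem_target hy)
  exact (contDiff_prodMk_right b.t₀).contMDiff.contMDiffOn

/-- On a flow box l is open onto its image: z ↦ `b.e.symm (τ x, b.P z)` is continuous near l x,
takes l x to x, and is a right inverse of l on the image. The germ at x is thus that of a fixed set
at the point l x. -/
theorem map_nhds_eq (hl : Continuous l) {x : M} (hx : x ∈ b.e.source) :
    map l (𝓝 x) = 𝓝[l '' b.e.source] (l x) := by
  apply le_antisymm
  · exact le_inf hl.continuousAt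
      (le_principal_iff.2 (image_mem_map (b.e.open_source.mem_nhds hx)))
  · have h1 : Tendsto (fun z => b.e.symm (τ x, b.P z)) (𝓝 (l x)) (𝓝 x) := by
      have h2 : ContinuousAt (fun z => b.e.symm (τ x, b.P z)) (l x) :=
        (b.e.continuousAt_symm (coords_mem_target hx)).comp (f := fun z => (τ x, b.P z))
          (by fun_prop)
      have h3 := h2.tendsto
      simp only [symm_coords hx] at h3
      exact h3
    have h4 : (fun z => l (b.e.symm (τ x, b.P z))) =ᶠ[𝓝[l '' b.e.source] (l x)] id := by
      filter_upwards [self_mem_nhdsWithin]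
      rintro _ ⟨y, hy, rfl⟩
      rw [l_symm (mem_target.2 ⟨τ_mem hx, proj_mem hy⟩), param_proj hy]
      rfl
    calc 𝓝[l '' b.e.source] (l x)
        = map (fun z => l (b.e.symm (τ x, b.P z))) (𝓝[l '' b.e.source] (l x)) := by
          rw [map_congr h4, map_id]
      _ = map l (map (fun z => b.e.symm (τ x, b.P z)) (𝓝[l '' b.e.source] (l x))) := map_map.symm
      _ ≤ map l (𝓝 x) := map_mono (h1.mono_left nhdsWithin_le_nhds)

end FlowBox

/-- This makes P ∘ l injective on the germs coming from a single flow box, so that it can serve as a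
chart. -/
theorem FlowBox.sameGerm_of_proj_eq {b : FlowBox E K r τ l} (hl : Continuous l) {x y : M}
    (hx : x ∈ b.e.source) (hy : y ∈ b.e.source) (h : b.P (l x) = b.P (l y)) : SameGerm l x y := by
  have h' := b.eq_of_proj_eq x hx y hy h
  exact ⟨h', by rw [FlowBox.map_nhds_eq hl hx, FlowBox.map_nhds_eq hl hy, h']⟩

namespace GermSpace

/-- Equality of germs is an open condition. If the images of two flow boxes have the same germ at a
common value, they agree near it, so every point close to q has a partner close to p with the same
value and the same germ. -/
theorem isOpenMap_mk (hl : Continuous l) (hbox : ∀ p, ∃ b : FlowBox E K r τ l, p ∈ b.e.source) :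
    IsOpenMap (mk l) := by
  intro U hU
  have : IsOpen (mk l ⁻¹' (mk l '' U)) := by
    rw [isOpen_iff_mem_nhds]
    rintro q ⟨p, hp, hpq⟩
    obtain ⟨b, hb⟩ := hbox p
    obtain ⟨b', hb'⟩ := hbox q
    obtain ⟨h1, h2⟩ := mk_eq_mk.1 hpq
    have h3 : ∀ᶠ q' in 𝓝 q, l q' ∈ l '' (b.e.source ∩ U) := by
      have : l '' (b.e.source ∩ U) ∈ map l (𝓝 q) := by
        rw [← h2]
        exact image_mem_map ((b.e.open_source.inter hU).mem_nhds ⟨hb, hp⟩)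
      exact this
    have h4 : ∀ᶠ q' in 𝓝 q, 𝓝[l '' b.e.source] (l q') = 𝓝[l '' b'.e.source] (l q') := by
      rw [FlowBox.map_nhds_eq hl hb, FlowBox.map_nhds_eq hl hb', h1] at h2
      have h5 := eventually_eventually_nhds.2 (nhdsWithin_eq_iff_eventuallyEq.1 h2)
      filter_upwards [hl.continuousAt.eventually h5] with q' hq'
      exact nhdsWithin_eq_iff_eventuallyEq.2 hq'
    filter_upwards [h3, h4, b'.e.open_source.mem_nhds hb'] with q' ⟨p', hp', e1⟩ e2 e3
    refine ⟨p', hp'.2, mk_eq_mk.2 ⟨e1, ?_⟩⟩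
    rw [FlowBox.map_nhds_eq hl hp'.1, FlowBox.map_nhds_eq hl e3, e1, e2]
  exact isQuotientMap_quotient_mk'.isOpen_preimage.1 this

theorem secondCountableTopology [SecondCountableTopology M] (hl : Continuous l)
    (hbox : ∀ p, ∃ b : FlowBox E K r τ l, p ∈ b.e.source) :
    SecondCountableTopology (GermSpace l) :=
  TopologicalSpace.Quotient.secondCountableTopology (isOpenMap_mk hl hbox)

/-- The chart of the space of germs defined by a flow box. -/
def chart (hl : Continuous l) (hbox : ∀ p, ∃ b : FlowBox E K r τ l, p ∈ b.e.source)
    (b : FlowBox E K r τ l) : OpenPartialHomeomorph (GermSpace l) K where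
  toFun s := b.P (lift s)
  invFun y := mk l (b.e.symm (b.t₀, y))
  source := mk l '' b.e.source
  target := b.B
  map_source' := by
    rintro _ ⟨x, hx, rfl⟩
    exact FlowBox.proj_mem hx
  map_target' y hy := mem_image_of_mem _ (b.e.map_target (FlowBox.t₀_mem_target hy))
  left_inv' := by
    rintro _ ⟨x, hx, rfl⟩
    have h := FlowBox.t₀_mem_target (FlowBox.proj_mem hx)
    exact mk_eq_mk.2 (FlowBox.sameGerm_of_proj_eq hl (b.e.map_target h) hx (FlowBox.proj_symm h))
  right_inv' y hy := FlowBox.proj_param hy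
  open_source := isOpenMap_mk hl hbox _ b.e.open_source
  open_target := b.isOpen_B
  continuousOn_toFun := (b.P.continuous.comp (continuous_lift hl)).continuousOn
  continuousOn_invFun := continuous_mk.comp_continuousOn
    (b.e.continuousOn_symm.comp (by fun_prop) fun y hy => FlowBox.t₀_mem_target hy)

/-- The charts of the space of germs. -/
@[reducible]
noncomputable def chartedSpace (hl : Continuous l)
    (hbox : ∀ p, ∃ b : FlowBox E K r τ l, p ∈ b.e.source) : ChartedSpace K (GermSpace l) where
  atlas := range (chart hl hbox)
  chartAt s := chart hl hbox (hbox (Quotient.out s)).choose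
  mem_chart_source s := ⟨Quotient.out s, (hbox (Quotient.out s)).choose_spec, Quotient.out_eq s⟩
  chart_mem_atlas _ := mem_range_self _

/-- The change of charts between two boxes is y ↦ P'(l(y)), where l is written as a function of the
coordinate of the first box. It is regular on all of that box. -/
theorem isManifold (hl : ContMDiff 𝓘(ℝ, E) 𝓘(ℝ, V) r l)
    (hbox : ∀ p, ∃ b : FlowBox E K r τ l, p ∈ b.e.source) :
    letI := chartedSpace hl.continuous hbox
    IsManifold 𝓘(ℝ, K) r (GermSpace l) := by
  let _ := chartedSpace hl.continuous hbox
  apply isManifold_of_contDiffOn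
  rintro _ _ ⟨b, rfl⟩ ⟨b', rfl⟩
  have h1 : ContDiffOn ℝ r (fun y => b'.P (b.param y)) b.B :=
    b'.P.contDiff.comp_contDiffOn (FlowBox.contDiffOn_param hl)
  refine h1.mono ?_
  rintro y ⟨hy, -⟩
  exact hy.1

section Manifold

variable (hl : ContMDiff 𝓘(ℝ, E) 𝓘(ℝ, V) r l)
    (hbox : ∀ p, ∃ b : FlowBox E K r τ l, p ∈ b.e.source)

theorem chart_mem_maximalAtlas (b : FlowBox E K r τ l) :
    letI := chartedSpace hl.continuous hbox
    chart hl.continuous hbox b ∈ IsManifold.maximalAtlas 𝓘(ℝ, K) r (GermSpace l) := by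
  let _ := chartedSpace hl.continuous hbox
  have := isManifold hl hbox
  exact IsManifold.subset_maximalAtlas (mem_range_self b)

theorem contMDiff_lift :
    letI := chartedSpace hl.continuous hbox
    ContMDiff 𝓘(ℝ, K) 𝓘(ℝ, V) r (lift : GermSpace l → V) := by
  let _ := chartedSpace hl.continuous hbox
  have := isManifold hl hbox
  intro s
  obtain ⟨p, rfl⟩ := mk_surjective s
  obtain ⟨b, hb⟩ := hbox p
  have h1 : ContMDiffOn 𝓘(ℝ, K) 𝓘(ℝ, V) r (b.param ∘ chart hl.continuous hbox b)
      (chart hl.continuous hbox b).source :=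
    (contMDiffOn_iff_contDiffOn.2 (FlowBox.contDiffOn_param hl)).comp
      (contMDiffOn_of_mem_maximalAtlas (chart_mem_maximalAtlas hl hbox b))
      (chart hl.continuous hbox b).mapsTo
  have hs := (chart hl.continuous hbox b).open_source.mem_nhds (mem_image_of_mem (mk l) hb)
  refine (h1.congr ?_).contMDiffAt hs
  rintro _ ⟨x, hx, rfl⟩
  exact (FlowBox.param_proj hx).symm

theorem contMDiff_mk [IsManifold 𝓘(ℝ, E) r M] :
    letI := chartedSpace hl.continuous hbox
    ContMDiff 𝓘(ℝ, E) 𝓘(ℝ, K) r (mk l) := by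
  let _ := chartedSpace hl.continuous hbox
  have := isManifold hl hbox
  intro p
  obtain ⟨b, hb⟩ := hbox p
  have h1 : ContMDiffOn 𝓘(ℝ, E) 𝓘(ℝ, K) r ((chart hl.continuous hbox b).symm ∘ b.P ∘ l)
      b.e.source :=
    (contMDiffOn_symm_of_mem_maximalAtlas (chart_mem_maximalAtlas hl hbox b)).comp
      (b.P.contMDiff.comp hl).contMDiffOn fun x hx => FlowBox.proj_mem hx
  refine (h1.congr fun x hx => ?_).contMDiffAt (b.e.open_source.mem_nhds hb)
  exact ((chart hl.continuous hbox b).left_inv (mem_image_of_mem _ hx)).symm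

/-- In the coordinates of a flow box on M and of the induced chart on the quotient, this map is the
identity. -/
theorem isLocalDiffeomorph [IsManifold 𝓘(ℝ, E) r M] (hτ : ContMDiff 𝓘(ℝ, E) 𝓘(ℝ, ℝ) r τ) :
    letI := chartedSpace hl.continuous hbox
    IsLocalDiffeomorph 𝓘(ℝ, E) (𝓘(ℝ, ℝ).prod 𝓘(ℝ, K)) r (fun p => (τ p, mk l p)) := by
  let _ := chartedSpace hl.continuous hbox
  have := isManifold hl hbox
  intro p
  obtain ⟨b, hb⟩ := hbox p
  let c := chart hl.continuous hbox b
  refine ⟨⟨⟨fun p => (τ p, mk l p), fun z => b.e.symm (z.1, c z.2), b.e.source,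
    Ioo (b.t₀ - b.ε) (b.t₀ + b.ε) ×ˢ c.source, ?_, ?_, ?_, ?_⟩, b.e.open_source,
    isOpen_Ioo.prod c.open_source, ?_, ?_⟩, hb, fun _ _ => rfl⟩
  · exact fun x hx => ⟨FlowBox.τ_mem hx, mem_image_of_mem _ hx⟩
  · exact fun z hz => b.e.map_target (FlowBox.mem_target.2 ⟨hz.1, c.map_source hz.2⟩)
  · exact fun x hx => FlowBox.symm_coords hx
  · rintro ⟨t, s⟩ ⟨ht, hs⟩
    have hz : (t, c s) ∈ b.e.target := FlowBox.mem_target.2 ⟨ht, c.map_source hs⟩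
    refine Prod.ext (FlowBox.τ_symm hz) ?_
    apply c.injOn (mem_image_of_mem _ (b.e.map_target hz)) hs
    exact FlowBox.proj_symm hz
  · exact (hτ.prodMk (contMDiff_mk hl hbox)).contMDiffOn
  · refine b.contMDiffOn_symm.comp (t := b.e.target) ?_ fun z hz =>
      FlowBox.mem_target.2 ⟨hz.1, c.map_source hz.2⟩
    have h2 : ContMDiffOn 𝓘(ℝ, K) 𝓘(ℝ, K) r c c.source :=
      contMDiffOn_of_mem_maximalAtlas (chart_mem_maximalAtlas hl hbox b)
    exact contMDiff_fst.contMDiffOn.prodMk_space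
      (h2.comp contMDiff_snd.contMDiffOn fun z hz => hz.2)

end Manifold

end GermSpace

/-- Identity theorem for germs of images: if `l` is analytic and `l p = l q`, then points close to
`p` and `q` cannot have the same germ unless `p` and `q` do. -/
theorem sameGerm_of_analytic {τ : M → ℝ} {l : M → V} [CompleteSpace V]
    (hl : ContMDiff 𝓘(ℝ, E) 𝓘(ℝ, V) ω l)
    (b b' : FlowBox E K ω τ l) {p q : M} (hp : p ∈ b.e.source) (hq : q ∈ b'.e.source)
    (hpq : l p = l q) :
    ∃ W ∈ 𝓝 q, ∀ p' ∈ b.e.source, ∀ q' ∈ W, SameGerm l p' q' → l '' W ⊆ l '' b.e.source := by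
  let f : ℝ × K → V := fun z => l (b'.e.symm z)
  have hf : ContDiffOn ℝ ω f b'.e.target :=
    contMDiffOn_iff_contDiffOn.1 (hl.comp_contMDiffOn b'.contMDiffOn_symm)
  have hO : IsOpen (b'.e.target ∩ f ⁻¹' (b.P ⁻¹' b.B)) :=
    hf.continuousOn.isOpen_inter_preimage b'.e.open_target (b.isOpen_B.preimage b.P.continuous)
  have hz₀ : b'.e q ∈ b'.e.target ∩ f ⁻¹' (b.P ⁻¹' b.B) := by
    refine ⟨b'.e.map_source hq, ?_⟩
    simp only [mem_preimage, f, b'.e.left_inv hq, ← hpq]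
    exact FlowBox.proj_mem hp
  obtain ⟨δ, hδ, hball⟩ := Metric.isOpen_iff.1 hO _ hz₀
  set D := Metric.ball (b'.e q) δ with hD
  -- On D the point P(f z) lies in the base of the box `b`, and f z is in the image of that box as
  -- soon as this difference vanishes. It is analytic on a connected ball and vanishes near one
  -- point of D, namely the coordinates of q', hence on the whole ball. The ball is fixed before p'
  -- and q' are chosen, which the Hausdorff property requires.
  have hΘ : ContDiffOn ℝ ω (fun z => b.param (b.P (f z)) - f z) D :=
    (((FlowBox.contDiffOn_param hl).comp (b.P.contDiff.comp_contDiffOn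
      (hf.mono (t := b'.e.target ∩ f ⁻¹' (b.P ⁻¹' b.B)) inter_subset_left)) fun z hz => hz.2).mono hball).sub
      (hf.mono fun z hz => (hball hz).1)
  have hΘa : AnalyticOnNhd ℝ (fun z => b.param (b.P (f z)) - f z) D := fun z hz =>
    (hΘ.contDiffAt (Metric.isOpen_ball.mem_nhds hz)).analyticAt
  refine ⟨b'.e.source ∩ b'.e ⁻¹' D,
    (b'.e.isOpen_inter_preimage Metric.isOpen_ball).mem_nhds ⟨hq, Metric.mem_ball_self hδ⟩, ?_⟩
  rintro p' hp' q' ⟨hq', hq'D⟩ ⟨-, hmap⟩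
  have h1 : ∀ᶠ x in 𝓝 q', l x ∈ l '' b.e.source := by
    have : l '' b.e.source ∈ map l (𝓝 q') := by
      rw [← hmap]; exact image_mem_map (b.e.open_source.mem_nhds hp')
    exact this
  have h2 : (fun z => b.param (b.P (f z)) - f z) =ᶠ[𝓝 (b'.e q')] 0 := by
    have h3 : Tendsto b'.e.symm (𝓝 (b'.e q')) (𝓝 q') := by
      have := (b'.e.continuousAt_symm (b'.e.map_source hq')).tendsto
      rwa [b'.e.left_inv hq'] at this
    filter_upwards [h3.eventually h1] with z hz
    obtain ⟨x, hx, hxz⟩ := hz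
    change b.param (b.P (l (b'.e.symm z))) - l (b'.e.symm z) = 0
    rw [← hxz, FlowBox.param_proj hx, sub_self]
  have h4 := hΘa.eqOn_zero_of_preconnected_of_eventuallyEq_zero
    (convex_ball _ _).isPreconnected hq'D h2
  rintro _ ⟨x, ⟨hx, hxD⟩, rfl⟩
  have h5 : b.param (b.P (f (b'.e x))) - f (b'.e x) = 0 := h4 hxD
  have h6 : f (b'.e x) = l x := by simp only [f, b'.e.left_inv hx]
  have h7 : b.P (l x) ∈ b.B := by rw [← h6]; exact (hball hxD).2
  rw [h6, sub_eq_zero] at h5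
  exact ⟨b.e.symm (b.t₀, b.P (l x)), b.e.map_target (FlowBox.t₀_mem_target h7), h5⟩

/-- Different values are separated by continuity of `lift`. Two analytic germs with the same value
that could not be separated would share germs at nearby points. The identity theorem, applied in
both directions, then places the image near each point inside the image of the flow box at the
other, so the germs agree. -/
theorem GermSpace.t2Space (hl : ContMDiff 𝓘(ℝ, E) 𝓘(ℝ, V) r l) [CompleteSpace V]
    (hbox : ∀ p, ∃ b : FlowBox E K r τ l, p ∈ b.e.source)
    (h : r = ω ∨ ∀ p q, l p = l q → SameGerm l p q) : T2Space (GermSpace l) := by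
  constructor
  intro s s' hss
  by_cases hls : lift s = lift s'
  · obtain ⟨p, rfl⟩ := mk_surjective s
    obtain ⟨q, rfl⟩ := mk_surjective s'
    have hpq : l p = l q := hls
    rcases h with rfl | h
    · obtain ⟨b, hb⟩ := hbox p
      obtain ⟨b', hb'⟩ := hbox q
      obtain ⟨W, hW, hWb⟩ := sameGerm_of_analytic hl b b' hb hb' hpq
      obtain ⟨W', hW', hWb'⟩ := sameGerm_of_analytic hl b' b hb' hb hpq.symm
      obtain ⟨O, hO1, hO2, hO3⟩ := mem_nhds_iff.1 (inter_mem hW (b'.e.open_source.mem_nhds hb'))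
      obtain ⟨O', hO1', hO2', hO3'⟩ :=
        mem_nhds_iff.1 (inter_mem hW' (b.e.open_source.mem_nhds hb))
      refine ⟨mk l '' O', mk l '' O, isOpenMap_mk hl.continuous hbox _ hO2',
        isOpenMap_mk hl.continuous hbox _ hO2, mem_image_of_mem _ hO3', mem_image_of_mem _ hO3, ?_⟩
      rw [Set.disjoint_left]
      rintro _ ⟨p', hp', rfl⟩ ⟨q', hq', e⟩
      apply hss
      have hg := mk_eq_mk.1 e
      have i1 := hWb p' (hO1' hp').2 q' (hO1 hq').1 ⟨hg.1.symm, hg.2.symm⟩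
      have i2 := hWb' q' (hO1 hq').2 p' (hO1' hp').1 hg
      refine mk_eq_mk.2 ⟨hpq, le_antisymm ?_ ?_⟩
      · rw [FlowBox.map_nhds_eq hl.continuous hb']
        refine le_inf (hpq ▸ hl.continuous.continuousAt) (le_principal_iff.2 ?_)
        exact mem_of_superset (image_mem_map hW') i2
      · rw [FlowBox.map_nhds_eq hl.continuous hb]
        refine le_inf (hpq ▸ hl.continuous.continuousAt) (le_principal_iff.2 ?_)
        exact mem_of_superset (image_mem_map hW) i1
    · exact absurd (mk_eq_mk.2 (h p q hpq)) hss
  · obtain ⟨O, O', h1, h2, h3, h4, h5⟩ := t2_separation hls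
    exact ⟨lift ⁻¹' O, lift ⁻¹' O', h1.preimage (continuous_lift hl.continuous),
      h2.preimage (continuous_lift hl.continuous), h3, h4, h5.preimage _⟩

end Germs

/-! ### Calculus of vector-valued maps on manifolds -/

section VectorDerivative

variable {E H M : Type*} [NormedAddCommGroup E] [NormedSpace ℝ E] [TopologicalSpace H]
  {I : ModelWithCorners ℝ E H} [TopologicalSpace M] [ChartedSpace H M]
  {V V' : Type*} [NormedAddCommGroup V] [NormedSpace ℝ V]
  [NormedAddCommGroup V'] [NormedSpace ℝ V'] {p : M}

theorem dvec_comp {Φ : V → V'} {f : M → V} (hΦ : DifferentiableAt ℝ Φ (f p))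
    (hf : MDifferentiableAt I 𝓘(ℝ, V) f p) (v : TangentSpace I p) :
    dvec I (fun q => Φ (f q)) p v = fderiv ℝ Φ (f p) (dvec I f p v) := by
  have := mfderiv_comp p hΦ.mdifferentiableAt hf
  rw [mfderiv_eq_fderiv] at this
  exact congrArg (fun A : E →L[ℝ] V' => A v) this

theorem dvec_clm (L : V →L[ℝ] V') {f : M → V} (hf : MDifferentiableAt I 𝓘(ℝ, V) f p)
    (v : TangentSpace I p) : dvec I (fun q => L (f q)) p v = L (dvec I f p v) := by
  rw [dvec_comp L.differentiableAt hf, L.fderiv]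

theorem dvec_prodMk {f : M → V} {f' : M → V'} (hf : MDifferentiableAt I 𝓘(ℝ, V) f p)
    (hf' : MDifferentiableAt I 𝓘(ℝ, V') f' p) (v : TangentSpace I p) :
    dvec I (fun q => (f q, f' q)) p v = (dvec I f p v, dvec I f' p v) := by
  have h := (hf.prodMk_space hf')
  exact Prod.ext (dvec_clm (ContinuousLinearMap.fst ℝ V V') h v).symm
    (dvec_clm (ContinuousLinearMap.snd ℝ V V') h v).symm

theorem dvec_add {f f' : M → V} (hf : MDifferentiableAt I 𝓘(ℝ, V) f p)
    (hf' : MDifferentiableAt I 𝓘(ℝ, V) f' p) (v : TangentSpace I p) :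
    dvec I (fun q => f q + f' q) p v = dvec I f p v + dvec I f' p v := by
  have := dvec_clm (ContinuousLinearMap.fst ℝ V V + ContinuousLinearMap.snd ℝ V V)
    (hf.prodMk_space hf') v
  rw [dvec_prodMk hf hf'] at this
  exact this

theorem dvec_sub {f f' : M → V} (hf : MDifferentiableAt I 𝓘(ℝ, V) f p)
    (hf' : MDifferentiableAt I 𝓘(ℝ, V) f' p) (v : TangentSpace I p) :
    dvec I (fun q => f q - f' q) p v = dvec I f p v - dvec I f' p v := by
  have := dvec_clm (ContinuousLinearMap.fst ℝ V V - ContinuousLinearMap.snd ℝ V V)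
    (hf.prodMk_space hf') v
  rw [dvec_prodMk hf hf'] at this
  exact this

theorem dvec_smul {c : M → ℝ} {f : M → V} (hc : MDifferentiableAt I 𝓘(ℝ, ℝ) c p)
    (hf : MDifferentiableAt I 𝓘(ℝ, V) f p) (v : TangentSpace I p) :
    dvec I (fun q => c q • f q) p v = dvec I c p v • f p + c p • dvec I f p v := by
  have h1 : HasFDerivAt (fun z : ℝ × V => z.1 • z.2) _ (c p, f p) :=
    (hasFDerivAt_fst (𝕜 := ℝ) (p := (c p, f p))).smul (hasFDerivAt_snd (𝕜 := ℝ) (p := (c p, f p)))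
  have := dvec_comp (f := fun q => (c q, f q)) (Φ := fun z : ℝ × V => z.1 • z.2) h1.differentiableAt
    (hc.prodMk_space hf) v
  rw [dvec_prodMk hc hf, h1.fderiv] at this
  rw [this]
  simp [add_comm]

theorem dvec_inner {W : Type*} [NormedAddCommGroup W] [InnerProductSpace ℝ W] {f f' : M → W}
    (hf : MDifferentiableAt I 𝓘(ℝ, W) f p) (hf' : MDifferentiableAt I 𝓘(ℝ, W) f' p)
    (v : TangentSpace I p) :
    dvec I (fun q => ⟪f q, f' q⟫_ℝ) p v = ⟪f p, dvec I f' p v⟫_ℝ + ⟪dvec I f p v, f' p⟫_ℝ := by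
  have h1 : HasFDerivAt (fun z : W × W => ⟪z.1, z.2⟫_ℝ) _ (f p, f' p) :=
    (hasFDerivAt_fst (𝕜 := ℝ) (p := (f p, f' p))).inner ℝ
      (hasFDerivAt_snd (𝕜 := ℝ) (p := (f p, f' p)))
  have := dvec_comp (f := fun q => (f q, f' q)) (Φ := fun z : W × W => ⟪z.1, z.2⟫_ℝ) h1.differentiableAt
    (hf.prodMk_space hf') v
  rw [dvec_prodMk hf hf', h1.fderiv] at this
  rw [this]
  simp [fderivInnerCLM_apply]

theorem dvec_const (c : V) (v : TangentSpace I p) : dvec I (fun _ => c) p v = 0 := by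
  have h : mfderiv I 𝓘(ℝ, V) (fun _ : M => c) p = 0 := mfderiv_const
  exact congrArg (fun A : E →L[ℝ] V => A v) h

/-- A unit vector field is orthogonal to its derivative. -/
theorem inner_dvec_of_norm_eq_one {W : Type*} [NormedAddCommGroup W] [InnerProductSpace ℝ W]
    {ν : M → W} (hν : MDifferentiableAt I 𝓘(ℝ, W) ν p) (h1 : ∀ q, ‖ν q‖ = 1)
    (v : TangentSpace I p) : ⟪ν p, dvec I ν p v⟫_ℝ = 0 := by
  have h := dvec_inner hν hν v
  have h' : (fun q => ⟪ν q, ν q⟫_ℝ) = fun _ => (1 : ℝ) := by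
    funext q; rw [real_inner_self_eq_norm_sq, h1, one_pow]
  rw [h', dvec_const, real_inner_comm (ν p)] at h
  linarith

variable {E' H' N : Type*} [NormedAddCommGroup E'] [NormedSpace ℝ E'] [TopologicalSpace H']
  {J : ModelWithCorners ℝ E' H'} [TopologicalSpace N] [ChartedSpace H' N]

theorem dvec_comp_map {f : N → V} {s : M → N} (hf : MDifferentiableAt J 𝓘(ℝ, V) f (s p))
    (hs : MDifferentiableAt I J s p) (v : TangentSpace I p) :
    dvec I (fun q => f (s q)) p v = dvec J f (s p) (mfderiv I J s p v) :=
  congrArg (fun A : E →L[ℝ] V => A v) (mfderiv_comp p hf hs)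

end VectorDerivative

/-! ### The Lorentzian form -/

section Lorentz

variable {n : ℕ}

theorem lorentz_apply (v w : Mink n) : lorentz v w = -(v.1 * w.1) + ⟪v.2, w.2⟫_ℝ := by
  simp [lorentz]

theorem height_eq (v : Mink n) : height v = v.1 := by
  simp [height, lorentz_apply]

/-- `lorentz` as a continuous linear map. -/
noncomputable def lorentzCLM (n : ℕ) : Mink n →L[ℝ] Mink n →L[ℝ] ℝ :=
  LinearMap.toContinuousLinearMap
    { toFun := lorentz
      map_add' := fun v w => by
        ext z <;> simp [lorentz_apply, inner_add_left]; ring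
      map_smul' := fun c v => by
        ext z <;> simp [lorentz_apply, inner_smul_left] }

theorem lorentzCLM_apply (v : Mink n) : lorentzCLM n v = lorentz v := rfl

theorem lorentz_injective : Injective (lorentzCLM n) := by
  rw [injective_iff_map_eq_zero]
  intro v hv
  have h1 := congrArg (fun A : Mink n →L[ℝ] ℝ => A (v.1, 0)) hv
  have h2 := congrArg (fun A : Mink n →L[ℝ] ℝ => A (0, v.2)) hv
  simp only [lorentzCLM_apply, lorentz_apply, zero_apply, inner_zero_right,
    mul_zero, neg_zero, zero_add, add_zero, neg_eq_zero, mul_self_eq_zero, inner_self_eq_zero]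
    at h1 h2
  exact Prod.ext h1 h2

/-- Recovers a normal field, together with its regularity, from the covector field that is part of a
wave front. -/
theorem exists_lorentz_leftInverse (n : ℕ) :
    ∃ R : (Mink n →L[ℝ] ℝ) →L[ℝ] Mink n, ∀ v, R (lorentz v) = v := by
  obtain ⟨R, hR⟩ := LinearMap.exists_leftInverse_of_injective (lorentzCLM n).toLinearMap
    (LinearMap.ker_eq_bot.2 lorentz_injective)
  exact ⟨LinearMap.toContinuousLinearMap R, fun v => LinearMap.congr_fun hR v⟩

end Lorentz

/-! ### The null direction tangent to a null front -/

section NullFronts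

variable {n : ℕ} {M : Type*} [TopologicalSpace M] [ChartedSpace (Euc n) M] {r : WithTop ℕ∞}

theorem inner_dvec_symm [IsManifold 𝓘(ℝ, Euc n) r M] (hr : 2 ≤ r) {g ν : M → Euc n}
    (hg : ContMDiff 𝓘(ℝ, Euc n) 𝓘(ℝ, Euc n) r g) (hν : ContMDiff 𝓘(ℝ, Euc n) 𝓘(ℝ, Euc n) r ν)
    (h : ∀ p v, ⟪ν p, dvec 𝓘(ℝ, Euc n) g p v⟫_ℝ = 0) (p : M) (u v : TangentSpace 𝓘(ℝ, Euc n) p) :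
    ⟪dvec 𝓘(ℝ, Euc n) g p u, dvec 𝓘(ℝ, Euc n) ν p v⟫_ℝ
      = ⟪dvec 𝓘(ℝ, Euc n) g p v, dvec 𝓘(ℝ, Euc n) ν p u⟫_ℝ := by
  have hr0 : r ≠ 0 := (zero_lt_two.trans_le hr).ne'
  let φ := chartAt (Euc n) p
  have hφ : φ ∈ IsManifold.maximalAtlas 𝓘(ℝ, Euc n) r M :=
    IsManifold.chart_mem_maximalAtlas (I := 𝓘(ℝ, Euc n)) (n := r) p
  have hp : p ∈ φ.source := mem_chart_source _ p
  have hφs : ContMDiffOn 𝓘(ℝ, Euc n) 𝓘(ℝ, Euc n) r φ.symm φ.target :=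
    contMDiffOn_symm_of_mem_maximalAtlas hφ
  have hφd : ∀ x ∈ φ.target, MDifferentiableAt 𝓘(ℝ, Euc n) 𝓘(ℝ, Euc n) φ.symm x := fun x hx =>
    ((hφs x hx).contMDiffAt (φ.open_target.mem_nhds hx)).mdifferentiableAt hr0
  have hφd' : MDifferentiableAt 𝓘(ℝ, Euc n) 𝓘(ℝ, Euc n) φ p :=
    (((contMDiffOn_of_mem_maximalAtlas hφ) p hp).contMDiffAt
      (φ.open_source.mem_nhds hp)).mdifferentiableAt hr0
  have fg := fun x hx => fderiv_comp_chart (hg.mdifferentiable hr0) (hφd x hx)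
  have fν := fun x hx => fderiv_comp_chart (hν.mdifferentiable hr0) (hφd x hx)
  have hx : φ p ∈ φ.target := φ.map_source hp
  have surj : Surjective (mfderiv 𝓘(ℝ, Euc n) 𝓘(ℝ, Euc n) φ.symm (φ p)) :=
    mfderiv_surjective_of_rightInverse (g := φ) (y := p) rfl (hφd _ hx) hφd'
      (φ.eventually_left_inverse hp)
  have key : ∀ u v : Euc n, _ := inner_fderiv_symm (g := g ∘ φ.symm) (ν := ν ∘ φ.symm) (x := φ p)
    ((((contMDiffOn_iff_contDiffOn.1 (hg.comp_contMDiffOn hφs)).contDiffAt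
      (φ.open_target.mem_nhds hx))).of_le hr)
    (((contMDiffOn_iff_contDiffOn.1 (hν.comp_contMDiffOn hφs)).contDiffAt
      (φ.open_target.mem_nhds hx)).differentiableAt hr0)
    (by
      filter_upwards [φ.open_target.mem_nhds hx] with y hy v
      rw [fg y hy]
      exact h _ _)
  have hpp : φ.symm (φ p) = p := φ.left_inv hp
  simp only [fg _ hx, fν _ hx] at key
  -- Stated over `φ.symm (φ p)`, where all tangent vectors come from the chart, so that the base
  -- point can afterwards be rewritten to p with the vectors still universally quantified.
  have main : ∀ u v : TangentSpace 𝓘(ℝ, Euc n) (φ.symm (φ p)),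
      ⟪dvec 𝓘(ℝ, Euc n) g (φ.symm (φ p)) u, dvec 𝓘(ℝ, Euc n) ν (φ.symm (φ p)) v⟫_ℝ
      = ⟪dvec 𝓘(ℝ, Euc n) g (φ.symm (φ p)) v, dvec 𝓘(ℝ, Euc n) ν (φ.symm (φ p)) u⟫_ℝ := by
    intro u v
    obtain ⟨u, rfl⟩ := surj u
    obtain ⟨v, rfl⟩ := surj v
    exact key u v
  rw [hpp] at main
  exact main u v

theorem two_le_of_smooth_or_analytic (hr : r = ∞ ∨ r = ω) : 2 ≤ r := by
  rcases hr with rfl | rfl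
  · exact WithTop.coe_le_coe.2 (le_top : (2 : ℕ∞) ≤ ⊤)
  · exact le_top

/-- The spatial part of the point where the light-like line through `F p` with direction `ξ p` meets
the hyperplane `τ = 0`. -/
def footpoint (F : M → Mink n) (ν : M → Euc n) (p : M) : Euc n := (F p).2 - (F p).1 • ν p

section Footpoint

variable {F : M → Mink n} {ν : M → Euc n} (hF : ContMDiff 𝓘(ℝ, Euc n) 𝓘(ℝ, Mink n) r F)
  (hν : ContMDiff 𝓘(ℝ, Euc n) 𝓘(ℝ, Euc n) r ν)
include hF

theorem contMDiff_height : ContMDiff 𝓘(ℝ, Euc n) 𝓘(ℝ, ℝ) r (fun p => (F p).1) :=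
  (ContinuousLinearMap.fst ℝ ℝ (Euc n)).contMDiff.comp hF

theorem contMDiff_spatial : ContMDiff 𝓘(ℝ, Euc n) 𝓘(ℝ, Euc n) r (fun p => (F p).2) :=
  (ContinuousLinearMap.snd ℝ ℝ (Euc n)).contMDiff.comp hF

theorem dvec_height (hr0 : r ≠ 0) (p : M) (v : TangentSpace 𝓘(ℝ, Euc n) p) :
    dvec 𝓘(ℝ, Euc n) (fun p => (F p).1) p v = (dvec 𝓘(ℝ, Euc n) F p v).1 :=
  dvec_clm (ContinuousLinearMap.fst ℝ ℝ (Euc n)) (hF.mdifferentiableAt hr0) v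

theorem dvec_spatial (hr0 : r ≠ 0) (p : M) (v : TangentSpace 𝓘(ℝ, Euc n) p) :
    dvec 𝓘(ℝ, Euc n) (fun p => (F p).2) p v = (dvec 𝓘(ℝ, Euc n) F p v).2 :=
  dvec_clm (ContinuousLinearMap.snd ℝ ℝ (Euc n)) (hF.mdifferentiableAt hr0) v

include hν

theorem contMDiff_footpoint : ContMDiff 𝓘(ℝ, Euc n) 𝓘(ℝ, Euc n) r (footpoint F ν) :=
  (contMDiff_spatial hF).sub ((contMDiff_height hF).smul hν)

theorem dvec_footpoint (hr0 : r ≠ 0) (p : M) (v : TangentSpace 𝓘(ℝ, Euc n) p) :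
    dvec 𝓘(ℝ, Euc n) (footpoint F ν) p v = (dvec 𝓘(ℝ, Euc n) F p v).2
      - ((dvec 𝓘(ℝ, Euc n) F p v).1 • ν p + (F p).1 • dvec 𝓘(ℝ, Euc n) ν p v) := by
  have h1 := (contMDiff_height hF).mdifferentiableAt (x := p) hr0
  have h2 := hν.mdifferentiableAt (x := p) hr0
  have h3 : MDifferentiableAt 𝓘(ℝ, Euc n) 𝓘(ℝ, Euc n) (fun q => (F q).1 • ν q) p := h1.smul h2
  have := dvec_sub ((contMDiff_spatial hF).mdifferentiableAt (x := p) hr0) h3 v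
  rw [dvec_smul h1 h2, dvec_spatial hF hr0, dvec_height hF hr0] at this
  exact this

end Footpoint

/-- With F = (τ, x) the foot point is x - τν. As ν ⟂ dν and |ν| = 1, pairing its differential with ν
leaves ⟪ν, dx⟫ - dτ, which is the Lorentzian product of (1, ν) and dF. -/
theorem inner_dvec_footpoint {F : M → Mink n} {ν : M → Euc n} (hr0 : r ≠ 0)
    (hF : ContMDiff 𝓘(ℝ, Euc n) 𝓘(ℝ, Mink n) r F)
    (hν : ContMDiff 𝓘(ℝ, Euc n) 𝓘(ℝ, Euc n) r ν) (h1 : ∀ p, ‖ν p‖ = 1)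
    (hnormal : ∀ (p : M) (v : TangentSpace 𝓘(ℝ, Euc n) p),
      lorentz ((1 : ℝ), ν p) (dvec 𝓘(ℝ, Euc n) F p v) = 0) (p : M)
    (v : TangentSpace 𝓘(ℝ, Euc n) p) :
    ⟪ν p, dvec 𝓘(ℝ, Euc n) (footpoint F ν) p v⟫_ℝ = 0 := by
  have h2 := hnormal p v
  rw [lorentz_apply] at h2
  rw [dvec_footpoint hF hν hr0, inner_sub_right, inner_add_right, inner_smul_right,
    inner_smul_right, inner_dvec_of_norm_eq_one (hν.mdifferentiableAt hr0) h1,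
    real_inner_self_eq_norm_sq, h1]
  simp only at h2
  linarith

/-- A Legendrian immersion into null covectors is tangent to the light-like direction. -/
theorem exists_null_tangent [IsManifold 𝓘(ℝ, Euc n) r M] (hr : 2 ≤ r) {F : M → Mink n}
    {ν : M → Euc n} (hF : ContMDiff 𝓘(ℝ, Euc n) 𝓘(ℝ, Mink n) r F)
    (hν : ContMDiff 𝓘(ℝ, Euc n) 𝓘(ℝ, Euc n) r ν) (h1 : ∀ p, ‖ν p‖ = 1)
    (hnormal : ∀ (p : M) (v : TangentSpace 𝓘(ℝ, Euc n) p),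
      lorentz ((1 : ℝ), ν p) (dvec 𝓘(ℝ, Euc n) F p v) = 0)
    (hinj : ∀ (p : M) (v : TangentSpace 𝓘(ℝ, Euc n) p),
      dvec 𝓘(ℝ, Euc n) F p v = 0 → dvec 𝓘(ℝ, Euc n) ν p v = 0 → v = 0) (p : M) :
    ∃ X : TangentSpace 𝓘(ℝ, Euc n) p, dvec 𝓘(ℝ, Euc n) F p X = ((1 : ℝ), ν p) ∧
      dvec 𝓘(ℝ, Euc n) ν p X = 0 := by
  have hr0 : r ≠ 0 := (zero_lt_two.trans_le hr).ne'
  have hg := contMDiff_footpoint hF hν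
  have hgν := inner_dvec_footpoint hr0 hF hν h1 hnormal
  have hν0 : ν p ≠ 0 := by
    intro h; have := h1 p; rw [h, norm_zero] at this; exact zero_ne_one this
  -- Here C is the differential of the foot point and B that of ν, both with values in ν^⊥.
  obtain ⟨X, hX0, hXg, hXν⟩ : ∃ X : TangentSpace 𝓘(ℝ, Euc n) p, X ≠ 0 ∧
      dvec 𝓘(ℝ, Euc n) (footpoint F ν) p X = 0 ∧ dvec 𝓘(ℝ, Euc n) ν p X = 0 :=
    exists_common_kernel (T := Euc n) rfl
    (mfderiv 𝓘(ℝ, Euc n) 𝓘(ℝ, Euc n) (footpoint F ν) p : Euc n →L[ℝ] Euc n).toLinearMap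
    (mfderiv 𝓘(ℝ, Euc n) 𝓘(ℝ, Euc n) ν p : Euc n →L[ℝ] Euc n).toLinearMap (ν p) hν0
    (hgν p) (inner_dvec_of_norm_eq_one (hν.mdifferentiableAt hr0) h1)
    (inner_dvec_symm hr hg hν hgν p)
  set w : Mink n := dvec 𝓘(ℝ, Euc n) F p X with hw
  have h2 : w.2 = w.1 • ν p := by
    rw [dvec_footpoint hF hν hr0, hXν, smul_zero, add_zero] at hXg
    exact sub_eq_zero.1 hXg
  -- By `h2`, dF(X) is the multiple w.1 of (1, ν). It cannot vanish, since (F, ν) is an immersion,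
  -- so X can be rescaled.
  have h3 : w.1 ≠ 0 := by
    intro h
    refine hX0 (hinj p X ?_ hXν)
    rw [← hw]
    exact Prod.ext h (by rw [h2, h, zero_smul]; rfl)
  refine ⟨w.1⁻¹ • X, ?_, ?_⟩
  · have : dvec 𝓘(ℝ, Euc n) F p (w.1⁻¹ • X) = w.1⁻¹ • w := map_smul _ _ _
    rw [this]
    refine Prod.ext (inv_mul_cancel₀ h3) ?_
    change w.1⁻¹ • w.2 = ν p
    rw [h2, smul_smul, inv_mul_cancel₀ h3, one_smul]
  · have : dvec 𝓘(ℝ, Euc n) ν p (w.1⁻¹ • X) = w.1⁻¹ • dvec 𝓘(ℝ, Euc n) ν p X := map_smul _ _ _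
    rw [this, hXν, smul_zero]

theorem IsENormal.eq_mk {F ξ : M → Mink n} (hξ : IsENormal 𝓘(ℝ, Euc n) r F ξ) (p : M) :
    ξ p = ((1 : ℝ), (ξ p).2) ∧ ‖(ξ p).2‖ = 1 := by
  have h1 := hξ.null p
  have h2 := hξ.norm p
  have h3 := hξ.future p
  rw [lorentz_apply, real_inner_self_eq_norm_sq] at h1
  rw [Real.sqrt_inj (by positivity) (by norm_num)] at h2
  have h4 : (ξ p).1 = 1 := by nlinarith
  have h5 : ‖(ξ p).2‖ = 1 := by
    have := norm_nonneg (ξ p).2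
    nlinarith
  exact ⟨Prod.ext h4 rfl, h5⟩

theorem IsENormal.contMDiff_snd {F ξ : M → Mink n} (hξ : IsENormal 𝓘(ℝ, Euc n) r F ξ) :
    ContMDiff 𝓘(ℝ, Euc n) 𝓘(ℝ, Euc n) r (fun p => (ξ p).2) :=
  contMDiff_spatial hξ.contMDiff

theorem IsNullFront.contMDiff {F : M → Mink n} (hF : IsNullFront 𝓘(ℝ, Euc n) r F) :
    ContMDiff 𝓘(ℝ, Euc n) 𝓘(ℝ, Mink n) r F := by
  obtain ⟨_, h, _⟩ := hF
  exact h.contMDiff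

/-- The E-normalized normal field `(1, ν)` of a null front `F` is tangent to `F`, with `ν` constant
in its direction, and `(F, ν)` is an immersion. -/
theorem IsNullFront.tangent_and_immersion [IsManifold 𝓘(ℝ, Euc n) r M] (hr : 2 ≤ r)
    {F ξ : M → Mink n} (hF : IsNullFront 𝓘(ℝ, Euc n) r F) (hξ : IsENormal 𝓘(ℝ, Euc n) r F ξ)
    (p : M) :
    (∃ X : TangentSpace 𝓘(ℝ, Euc n) p, dvec 𝓘(ℝ, Euc n) F p X = ((1 : ℝ), (ξ p).2) ∧
      dvec 𝓘(ℝ, Euc n) (fun p => (ξ p).2) p X = 0) ∧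
    ∀ v : TangentSpace 𝓘(ℝ, Euc n) p, dvec 𝓘(ℝ, Euc n) F p v = 0 →
      dvec 𝓘(ℝ, Euc n) (fun p => (ξ p).2) p v = 0 → v = 0 := by
  have hr0 : r ≠ 0 := (zero_lt_two.trans_le hr).ne'
  obtain ⟨ζ, hfront, hnull⟩ := hF
  obtain ⟨R, hR⟩ := exists_lorentz_leftInverse n
  have hζ : ContMDiff 𝓘(ℝ, Euc n) 𝓘(ℝ, Mink n) r ζ := by
    have := R.contMDiff.comp hfront.contMDiff_gauss
    simpa only [comp_def, hR] using this
  have hζd : ∀ p, MDifferentiableAt 𝓘(ℝ, Euc n) 𝓘(ℝ, Mink n) ζ p := fun p =>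
    hζ.mdifferentiableAt hr0
  have hnull' : ∀ p, ‖(ζ p).2‖ ^ 2 = (ζ p).1 ^ 2 := by
    intro p
    have := hnull p
    rw [lorentz_apply, real_inner_self_eq_norm_sq] at this
    linarith
  have hζ0 : ∀ p, (ζ p).1 ≠ 0 := by
    intro p h
    have h2 := hnull' p
    rw [h] at h2
    have h3 : (ζ p).2 = 0 := by simpa using h2
    refine hfront.ne_zero p ?_
    have h4 : ζ p = 0 := Prod.ext h h3
    change lorentz (ζ p) = 0
    rw [h4]
    exact map_zero (lorentzCLM n)
  -- The field ζ given by the front is a multiple of (1, μ). That μ is the direction of ξ is not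
  -- clear where dF drops rank, so the argument is run for μ first.
  let μ : M → Euc n := fun p => ((ζ p).1)⁻¹ • (ζ p).2
  have hc : ContMDiff 𝓘(ℝ, Euc n) 𝓘(ℝ, ℝ) r (fun p => ((ζ p).1)⁻¹) := fun p =>
    ((contMDiff_height hζ) p).inv₀ (hζ0 p)
  have hμ : ContMDiff 𝓘(ℝ, Euc n) 𝓘(ℝ, Euc n) r μ := hc.smul (contMDiff_spatial hζ)
  have hζμ : ∀ p, (ζ p).2 = (ζ p).1 • μ p := fun p => by
    simp only [μ, smul_smul, mul_inv_cancel₀ (hζ0 p), one_smul]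
  have hμ1 : ∀ p, ‖μ p‖ = 1 := by
    intro p
    have h2 := hnull' p
    have h3 : ‖(ζ p).2‖ = |(ζ p).1| := by
      rw [← abs_norm, ← sq_eq_sq_iff_abs_eq_abs]; exact h2
    simp only [μ, norm_smul, norm_inv, Real.norm_eq_abs, h3]
    exact inv_mul_cancel₀ (abs_ne_zero.2 (hζ0 p))
  have hμn : ∀ (p : M) (v : TangentSpace 𝓘(ℝ, Euc n) p),
      lorentz ((1 : ℝ), μ p) (dvec 𝓘(ℝ, Euc n) F p v) = 0 := by
    intro p v
    have h2 := hfront.mem_ker p v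
    have h3 : ((1 : ℝ), μ p) = ((ζ p).1)⁻¹ • ζ p :=
      Prod.ext (inv_mul_cancel₀ (hζ0 p)).symm rfl
    have h4 : lorentz (((ζ p).1)⁻¹ • ζ p) = ((ζ p).1)⁻¹ • lorentz (ζ p) :=
      map_smul (lorentzCLM n) _ _
    rw [h3, h4, smul_apply, h2, smul_zero]
  have hμi : ∀ (p : M) (v : TangentSpace 𝓘(ℝ, Euc n) p),
      dvec 𝓘(ℝ, Euc n) F p v = 0 → dvec 𝓘(ℝ, Euc n) μ p v = 0 → v = 0 := by
    intro p v h2 h3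
    -- If dμ(v) = 0, differentiating ζ = ζ₁(1, μ) gives dζ(v) = (dζ₁(v)/ζ₁) ζ, so the projective
    -- class is stationary along v.
    refine hfront.immersion p v h2 ⟨(dvec 𝓘(ℝ, Euc n) ζ p v).1 / (ζ p).1, ?_⟩
    have h4 : dvec 𝓘(ℝ, Euc n) (fun p => lorentz (ζ p)) p v = lorentz (dvec 𝓘(ℝ, Euc n) ζ p v) :=
      dvec_clm (lorentzCLM n) (hζd p) v
    have h5 : (dvec 𝓘(ℝ, Euc n) ζ p v).2 = (dvec 𝓘(ℝ, Euc n) ζ p v).1 • μ p := by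
      have h6 := dvec_smul ((contMDiff_height hζ).mdifferentiableAt (x := p) hr0)
        (hμ.mdifferentiableAt hr0) v
      rw [h3, smul_zero, add_zero, dvec_height hζ hr0] at h6
      rw [← h6, ← dvec_spatial hζ hr0]
      congr 2
      funext q
      exact hζμ q
    have h7 : dvec 𝓘(ℝ, Euc n) ζ p v = ((dvec 𝓘(ℝ, Euc n) ζ p v).1 / (ζ p).1) • ζ p := by
      refine Prod.ext (div_mul_cancel₀ _ (hζ0 p)).symm (h5.trans ?_)
      rw [Prod.smul_snd, hζμ p, smul_smul _ (ζ p).1 (μ p), div_mul_cancel₀ _ (hζ0 p)]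
    rw [h4]
    conv_lhs => rw [h7]
    exact map_smul (lorentzCLM n) _ _
  have hμX := exists_null_tangent hr hfront.contMDiff hμ hμ1 hμn hμi
  -- The vector (1, μ) is tangent to F, so ξ is orthogonal to it, which says that two unit vectors
  -- have inner product 1.
  have hμν : μ = fun p => (ξ p).2 := by
    funext p
    obtain ⟨X, hX, -⟩ := hμX p
    have h2 := hξ.normal p X
    rw [hX, (hξ.eq_mk p).1, lorentz_apply] at h2
    simp only at h2
    refine ((inner_eq_one_iff_of_norm_eq_one (𝕜 := ℝ) (hξ.eq_mk p).2 (hμ1 p)).1 ?_).symm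
    linarith
  rw [hμν] at hμX hμi
  exact ⟨hμX p, hμi p⟩

end NullFronts

theorem contMDiff_subtypeVal_comp_iff {E H M : Type*} [NormedAddCommGroup E] [NormedSpace ℝ E]
    [TopologicalSpace H] {I : ModelWithCorners ℝ E H} [TopologicalSpace M] [ChartedSpace H M]
    {E' H' N : Type*} [NormedAddCommGroup E'] [NormedSpace ℝ E'] [TopologicalSpace H']
    {J : ModelWithCorners ℝ E' H'} [TopologicalSpace N] [ChartedSpace H' N] {r : WithTop ℕ∞}
    (U : TopologicalSpace.Opens N) (f : M → U) :
    ContMDiff I J r (Subtype.val ∘ f) ↔ ContMDiff I J r f :=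
  forall_congr' fun _ => ChartedSpace.liftPropWithinAt_subtypeVal_comp_iff ..

/-! ### The slice of a flow box as a submanifold -/

section Slice

open Filter Topology

variable {E V K : Type*} [NormedAddCommGroup E] [NormedSpace ℝ E]
  [NormedAddCommGroup V] [NormedSpace ℝ V] [NormedAddCommGroup K] [NormedSpace ℝ K]
  {M : Type*} [TopologicalSpace M] [ChartedSpace E M] {r : WithTop ℕ∞} {τ : M → ℝ} {l : M → V}

namespace FlowBox

/-- The source of a flow box, as an open set. -/
def opens (b : FlowBox E K r τ l) : TopologicalSpace.Opens M := ⟨b.e.source, b.e.open_source⟩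

/-- The slice `τ = t₀` of a flow box. -/
def slice (b : FlowBox E K r τ l) : Set M := {x | x ∈ b.e.source ∧ τ x = b.t₀}

theorem symm_mem_slice {b : FlowBox E K r τ l} {y : K} (hy : y ∈ b.B) :
    b.e.symm (b.t₀, y) ∈ b.slice :=
  ⟨b.e.map_target (t₀_mem_target hy), τ_symm (t₀_mem_target hy)⟩

/-- The projection of a flow box to its slice. -/
def toSlice (b : FlowBox E K r τ l) (q : b.opens) : b.slice :=
  ⟨b.e.symm (b.t₀, b.P (l q)), symm_mem_slice (proj_mem q.2)⟩

theorem toSlice_of_mem {b : FlowBox E K r τ l} (x : b.slice) : b.toSlice ⟨x, x.2.1⟩ = x := by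
  apply Subtype.ext
  change b.e.symm (b.t₀, b.P (l x)) = x
  rw [← x.2.2, symm_coords x.2.1]

theorem l_toSlice {b : FlowBox E K r τ l} (q : b.opens) : l (b.toSlice q) = l q :=
  (l_symm (t₀_mem_target (proj_mem q.2))).trans (param_proj q.2)

open Classical in
/-- The global chart `P ∘ l` of the slice of a flow box. -/
noncomputable def sliceChart (b : FlowBox E K r τ l) (hl : Continuous l) (x₀ : b.slice) :
    OpenPartialHomeomorph b.slice K where
  toFun x := b.P (l x)
  -- The value x₀ off `b.B` is arbitrary; it is needed only to make the function total.
  invFun y := if hy : y ∈ b.B then ⟨b.e.symm (b.t₀, y), symm_mem_slice hy⟩ else x₀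
  source := univ
  target := b.B
  map_source' x _ := proj_mem x.2.1
  map_target' _ _ := mem_univ _
  left_inv' x _ := by
    rw [dif_pos (proj_mem x.2.1)]
    exact toSlice_of_mem x
  right_inv' y hy := by
    rw [dif_pos hy]
    exact proj_param hy
  open_source := isOpen_univ
  open_target := b.isOpen_B
  continuousOn_toFun := (b.P.continuous.comp (hl.comp continuous_subtype_val)).continuousOn
  continuousOn_invFun := by
    rw [IsInducing.subtypeVal.continuousOn_iff]
    have h : ContinuousOn (fun y => b.e.symm (b.t₀, y)) b.B :=
      b.e.continuousOn_symm.comp (by fun_prop) fun y hy => t₀_mem_target hy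
    refine h.congr fun y hy => ?_
    rw [comp_apply, dif_pos hy]

theorem sliceChart_symm_proj {b : FlowBox E K r τ l} (hl : Continuous l) (x₀ : b.slice)
    (q : b.opens) : (b.sliceChart hl x₀).symm (b.P (l q)) = b.toSlice q :=
  dif_pos (proj_mem q.2)

/-- The manifold structure of the slice of a flow box. -/
@[reducible]
noncomputable def sliceChartedSpace (b : FlowBox E K r τ l) (hl : Continuous l) (x₀ : b.slice) :
    ChartedSpace K b.slice :=
  (b.sliceChart hl x₀).singletonChartedSpace rfl

section Manifold

variable (b : FlowBox E K r τ l) (hl : ContMDiff 𝓘(ℝ, E) 𝓘(ℝ, V) r l) (x₀ : b.slice)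

theorem slice_isManifold :
    letI := b.sliceChartedSpace hl.continuous x₀
    IsManifold 𝓘(ℝ, K) r b.slice := by
  let _ := b.sliceChartedSpace hl.continuous x₀
  apply isManifold_of_contDiffOn
  rintro _ _ rfl rfl
  refine contDiffOn_id.congr ?_
  rintro y ⟨hy, -⟩
  exact (b.sliceChart hl.continuous x₀).right_inv hy.1

theorem sliceChart_mem_maximalAtlas :
    letI := b.sliceChartedSpace hl.continuous x₀
    b.sliceChart hl.continuous x₀ ∈ IsManifold.maximalAtlas 𝓘(ℝ, K) r b.slice := by
  let _ := b.sliceChartedSpace hl.continuous x₀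
  have := b.slice_isManifold hl x₀
  exact IsManifold.subset_maximalAtlas (mem_singleton _)

theorem contMDiff_sliceChart :
    letI := b.sliceChartedSpace hl.continuous x₀
    ContMDiff 𝓘(ℝ, K) 𝓘(ℝ, K) r (fun x : b.slice => b.P (l x)) := by
  let _ := b.sliceChartedSpace hl.continuous x₀
  have := b.slice_isManifold hl x₀
  rw [← contMDiffOn_univ]
  exact contMDiffOn_of_mem_maximalAtlas (b.sliceChart_mem_maximalAtlas hl x₀)

theorem contMDiffOn_sliceChart_symm :
    letI := b.sliceChartedSpace hl.continuous x₀
    ContMDiffOn 𝓘(ℝ, K) 𝓘(ℝ, K) r (b.sliceChart hl.continuous x₀).symm b.B := by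
  let _ := b.sliceChartedSpace hl.continuous x₀
  have := b.slice_isManifold hl x₀
  exact contMDiffOn_symm_of_mem_maximalAtlas (b.sliceChart_mem_maximalAtlas hl x₀)

theorem contMDiff_slice_section {t : ℝ} (ht : t ∈ Ioo (b.t₀ - b.ε) (b.t₀ + b.ε)) :
    letI := b.sliceChartedSpace hl.continuous x₀
    ContMDiff 𝓘(ℝ, K) 𝓘(ℝ, E) r (fun x : b.slice => b.e.symm (t, b.P (l x))) := by
  let _ := b.sliceChartedSpace hl.continuous x₀
  have h := (contMDiff_const (c := t)).prodMk_space (b.contMDiff_sliceChart hl x₀)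
  exact b.contMDiffOn_symm.comp_contMDiff h fun x => mem_target.2 ⟨ht, proj_mem x.2.1⟩

theorem contMDiff_slice_val :
    letI := b.sliceChartedSpace hl.continuous x₀
    ContMDiff 𝓘(ℝ, K) 𝓘(ℝ, E) r (Subtype.val : b.slice → M) := by
  let _ := b.sliceChartedSpace hl.continuous x₀
  refine (b.contMDiff_slice_section hl x₀ t₀_mem).congr fun x => ?_
  exact (congrArg Subtype.val (toSlice_of_mem x)).symm

theorem contMDiff_toSlice :
    letI := b.sliceChartedSpace hl.continuous x₀
    ContMDiff 𝓘(ℝ, E) 𝓘(ℝ, K) r b.toSlice := by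
  let _ := b.sliceChartedSpace hl.continuous x₀
  have h := (b.contMDiffOn_sliceChart_symm hl x₀).comp_contMDiff
    (b.P.contMDiff.comp (hl.comp contMDiff_subtype_val)) fun q : b.opens => proj_mem q.2
  exact h.congr fun q => (sliceChart_symm_proj hl.continuous x₀ q).symm

/-- Maps that factor the identity of the slice through `P`, locally. -/
theorem mfderiv_injective_of_proj (hr0 : r ≠ 0) {E' H' N : Type*} [NormedAddCommGroup E']
    [NormedSpace ℝ E'] [TopologicalSpace H'] {J : ModelWithCorners ℝ E' H'} [TopologicalSpace N]
    [ChartedSpace H' N] {f : b.slice → N} {G : N → V}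
    (hG : ContMDiff J 𝓘(ℝ, V) r G) (hGf : ∀ x, G (f x) = l x) :
    letI := b.sliceChartedSpace hl.continuous x₀
    ContMDiff 𝓘(ℝ, K) J r f → ∀ x, Injective (mfderiv 𝓘(ℝ, K) J f x) := by
  let _ := b.sliceChartedSpace hl.continuous x₀
  intro hf x
  have hy : b.P (G (f x)) ∈ b.B := by rw [hGf]; exact proj_mem x.2.1
  have h1 : MDifferentiableAt 𝓘(ℝ, K) 𝓘(ℝ, K) (b.sliceChart hl.continuous x₀).symm
      (b.P (G (f x))) :=
    (((b.contMDiffOn_sliceChart_symm hl x₀) _ hy).contMDiffAt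
      (b.isOpen_B.mem_nhds hy)).mdifferentiableAt hr0
  have h2 : MDifferentiableAt J 𝓘(ℝ, K) (fun z => b.P (G z)) (f x) :=
    (b.P.contMDiff.comp hG).mdifferentiableAt hr0
  refine mfderiv_injective_of_leftInverse
    (g := (b.sliceChart hl.continuous x₀).symm ∘ fun z => b.P (G z))
    (hf.mdifferentiableAt hr0) (h1.comp (f x) h2) (Eventually.of_forall fun z => ?_)
  simp only [comp_apply, hGf]
  exact (b.sliceChart hl.continuous x₀).left_inv (mem_univ z)

theorem toSlice_submersion (hr0 : r ≠ 0) :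
    letI := b.sliceChartedSpace hl.continuous x₀
    IsCrSubmersion 𝓘(ℝ, E) 𝓘(ℝ, K) r b.toSlice := by
  let _ := b.sliceChartedSpace hl.continuous x₀
  refine ⟨b.contMDiff_toSlice hl x₀, fun q => ?_⟩
  have hq : τ (q : M) ∈ Ioo (b.t₀ - b.ε) (b.t₀ + b.ε) := τ_mem q.2
  have ht : ∀ x : b.slice, (τ (q : M), b.P (l x)) ∈ b.e.target := fun x =>
    mem_target.2 ⟨hq, proj_mem x.2.1⟩
  -- The slice translated to the height of q: a section of the projection that passes through q
  -- itself.
  let σ : b.slice → b.opens := fun x => ⟨b.e.symm (τ (q : M), b.P (l x)), b.e.map_target (ht x)⟩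
  have hσ : ContMDiff 𝓘(ℝ, K) 𝓘(ℝ, E) r σ :=
    (contMDiff_subtypeVal_comp_iff b.opens σ).1 (b.contMDiff_slice_section hl x₀ hq)
  refine mfderiv_surjective_of_rightInverse (g := σ) (y := b.toSlice q) ?_
    ((b.contMDiff_toSlice hl x₀).mdifferentiableAt hr0) (hσ.mdifferentiableAt hr0)
    (Eventually.of_forall fun x => ?_)
  · apply Subtype.ext
    change b.e.symm (τ (q : M), b.P (l (b.toSlice q))) = q
    rw [l_toSlice (b := b) q, symm_coords q.2]
  · apply Subtype.ext
    change b.e.symm (b.t₀, b.P (l (b.e.symm (τ (q : M), b.P (l x))))) = x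
    rw [proj_symm (ht x)]
    exact congrArg Subtype.val (toSlice_of_mem x)

theorem mem_slab {S : Type*} [TopologicalSpace S] {z : ℝ × S} :
    z ∈ slab b.t₀ (ENNReal.ofReal b.ε) S ↔ z.1 ∈ Ioo (b.t₀ - b.ε) (b.t₀ + b.ε) := by
  change ENNReal.ofReal |z.1 - b.t₀| < ENNReal.ofReal b.ε ↔ _
  rw [ENNReal.ofReal_lt_ofReal_iff b.ε_pos, abs_sub_lt_iff, mem_Ioo]
  constructor <;> rintro ⟨h1, h2⟩ <;> constructor <;> linarith

/-- A flow box is the product of an interval and its slice. -/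
noncomputable def slabDiffeomorph (hτ : ContMDiff 𝓘(ℝ, E) 𝓘(ℝ, ℝ) r τ) :
    letI := b.sliceChartedSpace hl.continuous x₀
    b.opens ≃ₘ^r⟮𝓘(ℝ, E), 𝓘(ℝ, ℝ).prod 𝓘(ℝ, K)⟯ slab b.t₀ (ENNReal.ofReal b.ε) b.slice :=
  letI := b.sliceChartedSpace hl.continuous x₀
  have hz : ∀ z : slab b.t₀ (ENNReal.ofReal b.ε) b.slice,
      (z.1.1, b.P (l z.1.2)) ∈ b.e.target := fun z =>
    mem_target.2 ⟨b.mem_slab.1 z.2, proj_mem z.1.2.2.1⟩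
  { toFun := fun q => ⟨(τ q, b.toSlice q), b.mem_slab.2 (τ_mem q.2)⟩
    invFun := fun z => ⟨b.e.symm (z.1.1, b.P (l z.1.2)), b.e.map_target (hz z)⟩
    left_inv := fun q => Subtype.ext <| by
      change b.e.symm (τ q, b.P (l (b.toSlice q))) = q
      rw [l_toSlice (b := b) q, symm_coords q.2]
    right_inv := fun z => by
      apply Subtype.ext
      refine Prod.ext (τ_symm (hz z)) (Subtype.ext ?_)
      change b.e.symm (b.t₀, b.P (l (b.e.symm (z.1.1, b.P (l z.1.2))))) = z.1.2
      rw [proj_symm (hz z)]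
      exact congrArg Subtype.val (toSlice_of_mem z.1.2)
    contMDiff_toFun := by
      apply (contMDiff_subtypeVal_comp_iff _ _).1
      exact (hτ.comp contMDiff_subtype_val).prodMk (b.contMDiff_toSlice hl x₀)
    contMDiff_invFun := by
      apply (contMDiff_subtypeVal_comp_iff _ _).1
      refine b.contMDiffOn_symm.comp_contMDiff (f := fun z :
        slab b.t₀ (ENNReal.ofReal b.ε) b.slice => (z.1.1, b.P (l z.1.2))) ?_ hz
      exact (contMDiff_fst.comp contMDiff_subtype_val).prodMk_space
        ((b.contMDiff_sliceChart hl x₀).comp (contMDiff_snd.comp contMDiff_subtype_val)) }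

theorem isEmbedding_slice (hl : Continuous l) (x₀ : b.slice) :
    IsEmbedding (fun x : b.slice => b.P (l x)) :=
  ((b.sliceChart hl x₀).isOpenEmbedding rfl).isEmbedding

end Manifold

end FlowBox

end Slice

/-! ### Wave fronts with a unit normal field -/

section UnitNormal

variable {n : ℕ}

/-- `w ↦ ⟪w, ·⟫` as a continuous linear map. -/
noncomputable def innerCLM (n : ℕ) : Euc n →L[ℝ] Euc n →L[ℝ] ℝ :=
  LinearMap.toContinuousLinearMap
    { toFun := fun w => innerSL ℝ w
      map_add' := fun v w => by ext z; simp
      map_smul' := fun c v => by ext z; simp }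

variable {E H M : Type*} [NormedAddCommGroup E] [NormedSpace ℝ E] [TopologicalSpace H]
  {I : ModelWithCorners ℝ E H} [TopologicalSpace M] [ChartedSpace H M] {r : WithTop ℕ∞}

/-- For a unit normal the projective condition becomes linear: dν is orthogonal to ν, so dν(v) ∈ ℝν
forces dν(v) = 0. -/
theorem isFrontWithUnitNormal_of_immersion (hr0 : r ≠ 0) {g ν : M → Euc n}
    (hg : ContMDiff I 𝓘(ℝ, Euc n) r g) (hν : ContMDiff I 𝓘(ℝ, Euc n) r ν) (h1 : ∀ p, ‖ν p‖ = 1)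
    (hn : ∀ p (v : TangentSpace I p), ⟪ν p, dvec I g p v⟫_ℝ = 0)
    (hi : ∀ p (v : TangentSpace I p), dvec I g p v = 0 → dvec I ν p v = 0 → v = 0) :
    IsFrontWithUnitNormal I r g ν := by
  refine ⟨hν, h1, hg, (innerCLM n).contMDiff.comp hν, fun p h => ?_, hn, fun p v h2 h3 => ?_⟩
  · have := congrArg (fun A : Euc n →L[ℝ] ℝ => A (ν p)) h
    simp [h1] at this
  · obtain ⟨c, hc⟩ := h3
    have h4 : dvec I (fun p => innerSL ℝ (ν p)) p v = innerSL ℝ (dvec I ν p v) :=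
      dvec_clm (innerCLM n) (hν.mdifferentiableAt hr0) v
    rw [h4] at hc
    have h5 := congrArg (fun A : Euc n →L[ℝ] ℝ => A (ν p)) hc
    have h6 := inner_dvec_of_norm_eq_one (hν.mdifferentiableAt (x := p) hr0) h1 v
    have h7 : c = 0 := by
      simp only [innerSL_apply_apply, smul_apply, real_inner_self_eq_norm_sq,
        h1, real_inner_comm (ν p), h6] at h5
      simpa using h5.symm
    rw [h7, zero_smul] at hc
    have h8 := congrArg (fun A : Euc n →L[ℝ] ℝ => A (dvec I ν p v)) hc
    simp only [innerSL_apply_apply, zero_apply, inner_self_eq_zero] at h8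
    exact hi p v h2 h8

theorem IsFrontWithUnitNormal.immersion {g ν : M → Euc n} (hr0 : r ≠ 0)
    (h : IsFrontWithUnitNormal I r g ν) (p : M) (v : TangentSpace I p) (h2 : dvec I g p v = 0)
    (h3 : dvec I ν p v = 0) : v = 0 := by
  refine h.2.2.immersion p v h2 ⟨0, ?_⟩
  have h4 : dvec I (fun p => innerSL ℝ (ν p)) p v = innerSL ℝ (dvec I ν p v) :=
    dvec_clm (innerCLM n) (h.1.mdifferentiableAt hr0) v
  rw [h4, h3, zero_smul]
  exact map_zero (innerCLM n)

end UnitNormal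

/-! ### The normal form -/

section NormalForm

variable {n : ℕ} {E H S : Type*} [NormedAddCommGroup E] [NormedSpace ℝ E] [TopologicalSpace H]
  {J : ModelWithCorners ℝ E H} [TopologicalSpace S] [ChartedSpace H S] {r : WithTop ℕ∞}
  {g ν : S → Euc n}

theorem normalForm_eq {S : Type*} (g ν : S → Euc n) :
    normalForm g ν = fun z : ℝ × S => (z.1, g z.2 + z.1 • ν z.2) := by
  funext z
  simp [normalForm]

theorem lorentz_normalFormField {S : Type*} {ν : S → Euc n} (h1 : ∀ x, ‖ν x‖ = 1) (z : ℝ × S) :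
    lorentz (normalFormField ν z) (normalFormField ν z) = 0 := by
  rw [lorentz_apply]
  simp [normalFormField, h1]

theorem contMDiff_normalForm (hg : ContMDiff J 𝓘(ℝ, Euc n) r g)
    (hν : ContMDiff J 𝓘(ℝ, Euc n) r ν) :
    ContMDiff (𝓘(ℝ, ℝ).prod J) 𝓘(ℝ, Mink n) r (normalForm g ν) := by
  rw [normalForm_eq]
  exact contMDiff_fst.prodMk_space
    ((hg.comp contMDiff_snd).add (contMDiff_fst.smul (hν.comp contMDiff_snd)))

theorem contMDiff_normalFormField (hν : ContMDiff J 𝓘(ℝ, Euc n) r ν) :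
    ContMDiff (𝓘(ℝ, ℝ).prod J) 𝓘(ℝ, Mink n) r (normalFormField ν) :=
  contMDiff_const.prodMk_space (hν.comp contMDiff_snd)

theorem dvec_comp_snd {V : Type*} [NormedAddCommGroup V] [NormedSpace ℝ V] {f : S → V} {z : ℝ × S}
    (hf : MDifferentiableAt J 𝓘(ℝ, V) f z.2) (w : TangentSpace (𝓘(ℝ, ℝ).prod J) z) :
    dvec (𝓘(ℝ, ℝ).prod J) (fun z : ℝ × S => f z.2) z w = dvec J f z.2 w.2 := by
  have := dvec_comp_map (I := 𝓘(ℝ, ℝ).prod J) (s := Prod.snd) hf mdifferentiableAt_snd w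
  rw [this, mfderiv_snd]
  rfl

theorem dvec_normalForm (hr0 : r ≠ 0) (hg : ContMDiff J 𝓘(ℝ, Euc n) r g)
    (hν : ContMDiff J 𝓘(ℝ, Euc n) r ν) (z : ℝ × S) (w : TangentSpace (𝓘(ℝ, ℝ).prod J) z) :
    dvec (𝓘(ℝ, ℝ).prod J) (normalForm g ν) z w
      = (w.1, dvec J g z.2 w.2 + (w.1 • ν z.2 + z.1 • dvec J ν z.2 w.2)) := by
  have h1 : MDifferentiableAt (𝓘(ℝ, ℝ).prod J) 𝓘(ℝ, ℝ) (fun z : ℝ × S => z.1) z :=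
    mdifferentiableAt_fst
  have h2 : MDifferentiableAt (𝓘(ℝ, ℝ).prod J) 𝓘(ℝ, Euc n) (fun z : ℝ × S => g z.2) z :=
    (hg.comp contMDiff_snd).mdifferentiableAt hr0
  have h3 : MDifferentiableAt (𝓘(ℝ, ℝ).prod J) 𝓘(ℝ, Euc n) (fun z : ℝ × S => ν z.2) z :=
    (hν.comp contMDiff_snd).mdifferentiableAt hr0
  have h4 : MDifferentiableAt (𝓘(ℝ, ℝ).prod J) 𝓘(ℝ, Euc n) (fun z : ℝ × S => z.1 • ν z.2) z :=
    h1.smul h3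
  have h6 : dvec (𝓘(ℝ, ℝ).prod J) (fun z : ℝ × S => z.1) z w = w.1 :=
    congrArg (fun A : ℝ × E →L[ℝ] ℝ => A w) mfderiv_fst
  have h5 : MDifferentiableAt (𝓘(ℝ, ℝ).prod J) 𝓘(ℝ, Euc n)
      (fun z : ℝ × S => g z.2 + z.1 • ν z.2) z := h2.add h4
  rw [normalForm_eq, dvec_prodMk h1 h5, h6]
  have h7 := dvec_add h2 h4 w
  rw [dvec_smul h1 h3, dvec_comp_snd (hg.mdifferentiableAt hr0),
    dvec_comp_snd (hν.mdifferentiableAt hr0), h6] at h7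
  exact congrArg (Prod.mk _) h7

theorem dvec_normalFormField (hr0 : r ≠ 0) (hν : ContMDiff J 𝓘(ℝ, Euc n) r ν) (z : ℝ × S)
    (w : TangentSpace (𝓘(ℝ, ℝ).prod J) z) :
    dvec (𝓘(ℝ, ℝ).prod J) (normalFormField ν) z w = (0, dvec J ν z.2 w.2) := by
  have h3 : MDifferentiableAt (𝓘(ℝ, ℝ).prod J) 𝓘(ℝ, Euc n) (fun z : ℝ × S => ν z.2) z :=
    (hν.comp contMDiff_snd).mdifferentiableAt hr0
  have := dvec_prodMk (f := fun _ => (1 : ℝ)) mdifferentiableAt_const h3 w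
  rw [dvec_const, dvec_comp_snd (hν.mdifferentiableAt hr0)] at this
  exact this

/-- The time component of dG(w) is that of w, so w is tangent to the factor S. There dν = 0 reduces
dG to dg, and (g, ν) is an immersion. -/
theorem eq_zero_of_dvec_normalForm (hr0 : r ≠ 0) (h : IsFrontWithUnitNormal J r g ν) (z : ℝ × S)
    (w : TangentSpace (𝓘(ℝ, ℝ).prod J) z)
    (h1 : dvec (𝓘(ℝ, ℝ).prod J) (normalForm g ν) z w = 0) (h2 : dvec J ν z.2 w.2 = 0) :
    w = 0 := by
  rw [dvec_normalForm hr0 h.2.2.contMDiff h.1, h2, smul_zero, add_zero] at h1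
  have h3 : w.1 = 0 := congrArg Prod.fst h1
  have h4 := congrArg Prod.snd h1
  rw [h3] at h4
  simp only [zero_smul, add_zero, Prod.snd_zero] at h4
  exact Prod.ext h3 (h.immersion hr0 z.2 w.2 h4 h2)

theorem legendrianLift_immersion (hr0 : r ≠ 0) (h : IsFrontWithUnitNormal J r g ν) :
    IsCrImmersion (𝓘(ℝ, ℝ).prod J) 𝓘(ℝ, Mink n × Mink n) r
      (legendrianLift (normalForm g ν) (normalFormField ν)) := by
  have hG := contMDiff_normalForm h.2.2.contMDiff h.1
  have hX := contMDiff_normalFormField h.1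
  refine ⟨hG.prodMk_space hX, fun z => ?_⟩
  refine (injective_iff_map_eq_zero
    (mfderiv (𝓘(ℝ, ℝ).prod J) 𝓘(ℝ, Mink n × Mink n)
      (legendrianLift (normalForm g ν) (normalFormField ν)) z)).2 fun w hw => ?_
  have h1 := dvec_prodMk (hG.mdifferentiableAt (x := z) hr0) (hX.mdifferentiableAt (x := z) hr0) w
  have h2 := h1.symm.trans hw
  have h3 := congrArg Prod.snd h2
  simp only [dvec_normalFormField hr0 h.1] at h3
  exact eq_zero_of_dvec_normalForm hr0 h z w (congrArg Prod.fst h2) (congrArg Prod.snd h3)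

theorem lorentz_dvec_normalForm (hr0 : r ≠ 0) (h : IsFrontWithUnitNormal J r g ν) (z : ℝ × S)
    (w : TangentSpace (𝓘(ℝ, ℝ).prod J) z) :
    lorentz (normalFormField ν z) (dvec (𝓘(ℝ, ℝ).prod J) (normalForm g ν) z w) = 0 := by
  have h1 : ⟪ν z.2, dvec J g z.2 w.2⟫_ℝ = 0 := h.2.2.mem_ker z.2 w.2
  have h2 : ⟪ν z.2, dvec J ν z.2 w.2⟫_ℝ = 0 :=
    inner_dvec_of_norm_eq_one (h.1.mdifferentiableAt hr0) h.2.1 w.2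
  rw [dvec_normalForm hr0 h.2.2.contMDiff h.1, lorentz_apply]
  simp only [normalFormField, inner_add_right, inner_smul_right, h1, real_inner_self_eq_norm_sq,
    h.2.1, h2]
  ring

theorem isNullFront_normalForm (hr0 : r ≠ 0) (h : IsFrontWithUnitNormal J r g ν) :
    IsNullFront (𝓘(ℝ, ℝ).prod J) r (normalForm g ν) := by
  have hX := contMDiff_normalFormField h.1
  refine ⟨normalFormField ν, ⟨contMDiff_normalForm h.2.2.contMDiff h.1,
    (lorentzCLM n).contMDiff.comp hX, fun z hz => ?_, lorentz_dvec_normalForm hr0 h,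
    fun z w h1 h2 => ?_⟩, lorentz_normalFormField h.2.1⟩
  · have h0 : normalFormField ν z = 0 := lorentz_injective (hz.trans (map_zero (lorentzCLM n)).symm)
    exact one_ne_zero (congrArg Prod.fst h0)
  · obtain ⟨c, hc⟩ := h2
    have h3 : dvec (𝓘(ℝ, ℝ).prod J) (fun z => lorentz (normalFormField ν z)) z w
        = lorentz (dvec (𝓘(ℝ, ℝ).prod J) (normalFormField ν) z w) :=
      dvec_clm (lorentzCLM n) (hX.mdifferentiableAt hr0) w
    have h4 : c • lorentz (normalFormField ν z) = lorentz (c • normalFormField ν z) :=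
      (map_smul (lorentzCLM n) _ _).symm
    rw [h3, h4] at hc
    have h5 := lorentz_injective hc
    rw [dvec_normalFormField hr0 h.1] at h5
    -- The time component of (1, ν) is constant, so its derivative can be parallel to it only with
    -- factor 0.
    have h6 : 0 = c * 1 := congrArg Prod.fst h5
    rw [mul_one] at h6
    rw [← h6, zero_smul] at h5
    exact eq_zero_of_dvec_normalForm hr0 h z w h1 (congrArg Prod.snd h5)

theorem isENormal_normalForm (hr0 : r ≠ 0) (h : IsFrontWithUnitNormal J r g ν) :
    IsENormal (𝓘(ℝ, ℝ).prod J) r (normalForm g ν) (normalFormField ν) where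
  contMDiff := contMDiff_normalFormField h.1
  normal := lorentz_dvec_normalForm hr0 h
  null := lorentz_normalFormField h.2.1
  future _ := one_pos
  norm z := by
    have : ‖(normalFormField ν z).2‖ = 1 := h.2.1 z.2
    rw [this]
    norm_num [normalFormField]

end NormalForm

/-! ### Open submanifolds and germs of embeddings -/

section Preliminaries

open Filter Topology

/-- The inclusion of an open submanifold has surjective differential. -/
theorem mfderiv_subtype_val_surjective {E H N : Type*} [NormedAddCommGroup E] [NormedSpace ℝ E]
    [TopologicalSpace H] {I : ModelWithCorners ℝ E H} [TopologicalSpace N] [ChartedSpace H N]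
    {r : WithTop ℕ∞} (hr0 : r ≠ 0) (O : TopologicalSpace.Opens N) (x : O) :
    Surjective (mfderiv I I (Subtype.val : O → N) x) := by
  classical
  -- A right inverse of the inclusion near x; its value off O is irrelevant.
  let s : N → O := fun y => if hy : y ∈ O then ⟨y, hy⟩ else x
  have hval : ∀ y ∈ O, ((s y : O) : N) = y := fun y hy => congrArg Subtype.val (dif_pos hy)
  have hs : ContMDiffAt I I r s x := by
    refine (ChartedSpace.liftPropWithinAt_subtypeVal_comp_iff ..).1 ?_
    have h : ContMDiffAt I I r (Subtype.val ∘ s) (x : N) :=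
      contMDiffAt_id.congr_of_eventuallyEq
        (by filter_upwards [O.isOpen.mem_nhds x.2] with y hy using hval y hy)
    exact h
  exact mfderiv_surjective_of_rightInverse (g := s) (y := (x : N)) (Subtype.ext (hval x x.2))
    ((contMDiff_subtype_val (n := r)).mdifferentiableAt hr0) (hs.mdifferentiableAt hr0)
    (by filter_upwards [O.isOpen.mem_nhds x.2] with y hy using hval y hy)

/-- Two embeddings have the same germ of image iff they are related. -/
theorem related_iff_map_nhds_eq {X Y Z : Type*} [TopologicalSpace X]
    [TopologicalSpace Y] [TopologicalSpace Z] {f : X → Z} {g : Y → Z} (hf : IsEmbedding f)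
    (hg : IsEmbedding g) {x : X} {y : Y} (hxy : f x = g y) :
    Related f g x y ↔ map f (𝓝 x) = map g (𝓝 y) := by
  constructor
  · rintro ⟨A, B, hA, hB, hxA, hyB, -, hAB⟩
    have hfA : map f (𝓝 x) = 𝓝[f '' A] (f x) := by
      rw [← hf.map_nhdsWithin_eq, hA.nhdsWithin_eq hxA]
    have hgB : map g (𝓝 y) = 𝓝[g '' B] (g y) := by
      rw [← hg.map_nhdsWithin_eq, hB.nhdsWithin_eq hyB]
    rw [hfA, hgB, hAB, hxy]
  · intro h
    rw [hf.map_nhds_eq, hg.map_nhds_eq, ← hxy, nhdsWithin_eq_iff_eventuallyEq,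
      eventuallyEq_set, eventually_nhds_iff] at h
    -- On W the two ranges agree, so the preimages of W have the same image.
    obtain ⟨W, hW, hWo, hxW⟩ := h
    refine ⟨f ⁻¹' W, g ⁻¹' W, hWo.preimage hf.continuous, hWo.preimage hg.continuous, hxW,
      by rwa [mem_preimage, ← hxy], hxy, ?_⟩
    rw [image_preimage_eq_inter_range, image_preimage_eq_inter_range]
    ext z
    exact ⟨fun hz => ⟨hz.1, (hW z hz.1).1 hz.2⟩, fun hz => ⟨hz.1, (hW z hz.1).2 hz.2⟩⟩

end Preliminaries

/-! ### Adopted sets and the relation ≈ -/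

section Adopted

open Filter Topology

variable {k : ℕ} {M : Type u} [TopologicalSpace M] [ChartedSpace (Euc (k + 1)) M]
  {r : WithTop ℕ∞} {F ξ : M → Mink (k + 1)}

/-- The pair of the foot point and the spatial direction of the light-like line through `F p` with
direction `ξ p`. -/
def lineMap (F ξ : M → Mink (k + 1)) (p : M) : Euc (k + 1) × Euc (k + 1) :=
  (footpoint F (fun p => (ξ p).2) p, (ξ p).2)

theorem contMDiff_lineMap (hF : ContMDiff 𝓘(ℝ, Euc (k + 1)) 𝓘(ℝ, Mink (k + 1)) r F)
    (hξ : IsENormal 𝓘(ℝ, Euc (k + 1)) r F ξ) :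
    ContMDiff 𝓘(ℝ, Euc (k + 1)) 𝓘(ℝ, Euc (k + 1) × Euc (k + 1)) r (lineMap F ξ) :=
  (contMDiff_footpoint hF hξ.contMDiff_snd).prodMk_space hξ.contMDiff_snd

theorem dvec_lineMap (hr0 : r ≠ 0) (hF : ContMDiff 𝓘(ℝ, Euc (k + 1)) 𝓘(ℝ, Mink (k + 1)) r F)
    (hξ : IsENormal 𝓘(ℝ, Euc (k + 1)) r F ξ) (p : M) (v : TangentSpace 𝓘(ℝ, Euc (k + 1)) p) :
    dvec 𝓘(ℝ, Euc (k + 1)) (lineMap F ξ) p v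
      = (dvec 𝓘(ℝ, Euc (k + 1)) (footpoint F (fun p => (ξ p).2)) p v,
        dvec 𝓘(ℝ, Euc (k + 1)) (fun p => (ξ p).2) p v) :=
  dvec_prodMk ((contMDiff_footpoint hF hξ.contMDiff_snd).mdifferentiableAt hr0)
    (hξ.contMDiff_snd.mdifferentiableAt hr0) v

theorem inner_dvec_footpoint_eNormal (hr0 : r ≠ 0)
    (hF : ContMDiff 𝓘(ℝ, Euc (k + 1)) 𝓘(ℝ, Mink (k + 1)) r F)
    (hξ : IsENormal 𝓘(ℝ, Euc (k + 1)) r F ξ) (p : M) (v : TangentSpace 𝓘(ℝ, Euc (k + 1)) p) :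
    ⟪(ξ p).2, dvec 𝓘(ℝ, Euc (k + 1)) (footpoint F (fun p => (ξ p).2)) p v⟫_ℝ = 0 :=
  inner_dvec_footpoint (ν := fun p => (ξ p).2) hr0 hF hξ.contMDiff_snd (fun p => (hξ.eq_mk p).2)
    (fun p v => by have := hξ.normal p v; rwa [(hξ.eq_mk p).1] at this) p v

theorem legendrianLift_eq (hξ : IsENormal 𝓘(ℝ, Euc (k + 1)) r F ξ) (p : M) :
    legendrianLift F ξ p = (((F p).1, (lineMap F ξ p).1 + (F p).1 • (lineMap F ξ p).2),
      ((1 : ℝ), (lineMap F ξ p).2)) := by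
  refine Prod.ext (Prod.ext rfl ?_) (hξ.eq_mk p).1
  simp [legendrianLift, lineMap, footpoint]

theorem legendrianLift_normalForm {S : Type*} {n : ℕ} (g ν : S → Euc n) (z : ℝ × S) :
    legendrianLift (normalForm g ν) (normalFormField ν) z
      = ((z.1, g z.2 + z.1 • ν z.2), ((1 : ℝ), ν z.2)) := by
  rw [normalForm_eq]
  rfl

/-- The null direction X has dτ(X) = 1 and is killed by the differential of `lineMap`, as lines do
not change when a point moves along them. Conversely, a vector killed by dτ, dν and the differential
of the foot point is killed by dF and dν, hence is zero. -/
theorem exists_frontBox [IsManifold 𝓘(ℝ, Euc (k + 1)) r M] (hr : 2 ≤ r)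
    (hF : IsNullFront 𝓘(ℝ, Euc (k + 1)) r F) (hξ : IsENormal 𝓘(ℝ, Euc (k + 1)) r F ξ) (p : M) :
    ∃ b : FlowBox (Euc (k + 1)) (Euc k) r (fun p => (F p).1) (lineMap F ξ), p ∈ b.e.source := by
  have hr0 : r ≠ 0 := (zero_lt_two.trans_le hr).ne'
  have hFc := hF.contMDiff
  have hfoot := dvec_footpoint hFc hξ.contMDiff_snd hr0
  refine exists_flowBox (by simp) (one_le_two.trans hr) (contMDiff_height hFc)
    (contMDiff_lineMap hFc hξ) (fun p => ?_) (fun p v h1 h2 => ?_) p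
  · obtain ⟨⟨X, hX1, hX2⟩, -⟩ := hF.tangent_and_immersion hr hξ p
    refine ⟨X, ?_, ?_⟩
    · rw [dvec_height hFc hr0, hX1]
    · rw [dvec_lineMap hr0 hFc hξ, hfoot, hX1, hX2]
      simp
  · rw [dvec_lineMap hr0 hFc hξ] at h2
    rw [dvec_height hFc hr0] at h1
    have h3 := congrArg Prod.fst h2
    have h4 := congrArg Prod.snd h2
    simp only [Prod.fst_zero, Prod.snd_zero] at h3 h4
    refine (hF.tangent_and_immersion hr hξ p).2 v ?_ h4
    rw [hfoot, h1, h4, zero_smul, smul_zero, add_zero, sub_zero] at h3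
    exact Prod.ext h1 h3

section OfFlowBox

variable (b : FlowBox (Euc (k + 1)) (Euc k) r (fun p => (F p).1) (lineMap F ξ)) (x₀ : b.slice)
  (hr0 : r ≠ 0) (hF : ContMDiff 𝓘(ℝ, Euc (k + 1)) 𝓘(ℝ, Mink (k + 1)) r F)
  (hξ : IsENormal 𝓘(ℝ, Euc (k + 1)) r F ξ)
include hr0

theorem isFront_slice :
    letI := b.sliceChartedSpace (contMDiff_lineMap hF hξ).continuous x₀
    IsFrontWithUnitNormal 𝓘(ℝ, Euc k) r (fun x : b.slice => (lineMap F ξ x).1)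
      (fun x : b.slice => (lineMap F ξ x).2) := by
  have hl := contMDiff_lineMap hF hξ
  let _ := b.sliceChartedSpace hl.continuous x₀
  have hv := b.contMDiff_slice_val hl x₀
  have hg : ContMDiff 𝓘(ℝ, Euc k) 𝓘(ℝ, Euc (k + 1)) r (fun x : b.slice => (lineMap F ξ x).1) :=
    (contMDiff_footpoint hF hξ.contMDiff_snd).comp hv
  have hν : ContMDiff 𝓘(ℝ, Euc k) 𝓘(ℝ, Euc (k + 1)) r (fun x : b.slice => (lineMap F ξ x).2) :=
    hξ.contMDiff_snd.comp hv
  refine isFrontWithUnitNormal_of_immersion hr0 hg hν (fun x => (hξ.eq_mk x).2) (fun x v => ?_)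
    fun x v h1 h2 => ?_
  · have h := dvec_comp_map (s := (Subtype.val : b.slice → M))
      ((contMDiff_footpoint hF hξ.contMDiff_snd).mdifferentiableAt hr0)
      (hv.mdifferentiableAt (x := x) hr0) v
    have h' := inner_dvec_footpoint_eNormal hr0 hF hξ x
      (mfderiv 𝓘(ℝ, Euc k) 𝓘(ℝ, Euc (k + 1)) (Subtype.val : b.slice → M) x v)
    rw [← h] at h'
    exact h'
  · have hi := b.mfderiv_injective_of_proj hl x₀ hr0 contMDiff_id
      (f := fun x : b.slice => lineMap F ξ x) (fun _ => rfl) (hl.comp hv) x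
    refine hi ((?_ : dvec 𝓘(ℝ, Euc k) (fun x : b.slice => lineMap F ξ x) x v = 0).trans
      (map_zero _).symm)
    have h3 := dvec_prodMk (hg.mdifferentiableAt (x := x) hr0) (hν.mdifferentiableAt (x := x) hr0) v
    rw [h1, h2] at h3
    exact h3

/-- The adopted structure of a flow box. -/
noncomputable def adoptedOfFlowBox : AdoptedData r F ξ b.opens :=
  letI := b.sliceChartedSpace (contMDiff_lineMap hF hξ).continuous x₀
  { ε := ENNReal.ofReal b.ε
    ε_pos := ENNReal.ofReal_pos.2 b.ε_pos
    t₀ := b.t₀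
    S := b.slice
    S_subset := fun _ hx => hx.1
    charted := b.sliceChartedSpace (contMDiff_lineMap hF hξ).continuous x₀
    manifold := b.slice_isManifold (contMDiff_lineMap hF hξ) x₀
    incl := ⟨b.contMDiff_slice_val (contMDiff_lineMap hF hξ) x₀,
      b.mfderiv_injective_of_proj (contMDiff_lineMap hF hξ) x₀ hr0 (contMDiff_lineMap hF hξ)
        (fun _ => rfl) (b.contMDiff_slice_val (contMDiff_lineMap hF hξ) x₀)⟩
    ρ := b.toSlice
    ρ_surjective := fun x => ⟨⟨x, x.2.1⟩, FlowBox.toSlice_of_mem x⟩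
    ρ_submersion := b.toSlice_submersion (contMDiff_lineMap hF hξ) x₀ hr0
    g := fun x => (lineMap F ξ x).1
    ν := fun x => (lineMap F ξ x).2
    front := isFront_slice b x₀ hr0 hF hξ
    ξ_eq := fun x => (hξ.eq_mk x).1
    g_comp := fun q => by
      have h := FlowBox.l_toSlice (b := b) q
      rw [h, height_eq, (hξ.eq_mk (b.toSlice q)).1]
      have h2 : (lineMap F ξ (b.toSlice q)).2 = (lineMap F ξ q).2 := congrArg Prod.snd h
      change (ξ (b.toSlice q)).2 = (ξ q).2 at h2
      rw [h2]
      refine Prod.ext ?_ rfl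
      simp
    Φ := b.slabDiffeomorph (contMDiff_lineMap hF hξ) x₀ (contMDiff_height hF)
    Φ_apply := fun q => by rw [height_eq]; rfl }

theorem adoptedOfFlowBox_strong : (adoptedOfFlowBox b x₀ hr0 hF hξ).Strong := by
  refine ⟨legendrianLift_immersion hr0 (adoptedOfFlowBox b x₀ hr0 hF hξ).front, ?_⟩
  -- Reads off from a point of the image of L its height t and the slice coordinate of its line, the
  -- foot point being the spatial part minus tν. Since κ ∘ L is an embedding, so is L.
  let κ : Mink (k + 1) × Mink (k + 1) → ℝ × Euc k :=
    fun z => (z.1.1, b.P (z.1.2 - z.1.1 • z.2.2, z.2.2))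
  have hκ : Continuous κ := by fun_prop
  have h : κ ∘ (adoptedOfFlowBox b x₀ hr0 hF hξ).L
      = Prod.map id (fun x : b.slice => b.P (lineMap F ξ x)) := by
    funext z
    rw [comp_apply, AdoptedData.L, legendrianLift_normalForm]
    refine Prod.ext rfl (congrArg b.P (Prod.ext ?_ rfl))
    exact add_sub_cancel_right _ _
  refine IsEmbedding.of_comp
    (legendrianLift_immersion hr0 (adoptedOfFlowBox b x₀ hr0 hF hξ).front).1.continuous hκ ?_
  rw [h]
  exact IsEmbedding.id.prodMap
    (b.isEmbedding_slice (contMDiff_lineMap hF hξ).continuous x₀)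

end OfFlowBox

theorem exists_strong_adopted [IsManifold 𝓘(ℝ, Euc (k + 1)) r M] (hr : 2 ≤ r)
    (hF : IsNullFront 𝓘(ℝ, Euc (k + 1)) r F) (hξ : IsENormal 𝓘(ℝ, Euc (k + 1)) r F ξ) (p : M) :
    ∃ (U : TopologicalSpace.Opens M) (D : AdoptedData r F ξ U), p ∈ U ∧ D.Strong := by
  have hr0 : r ≠ 0 := (zero_lt_two.trans_le hr).ne'
  obtain ⟨b, hb⟩ := exists_frontBox hr hF hξ p
  let x₀ : b.slice := b.toSlice ⟨p, hb⟩
  exact ⟨b.opens, adoptedOfFlowBox b x₀ hr0 hF.contMDiff hξ, hb,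
    adoptedOfFlowBox_strong b x₀ hr0 hF.contMDiff hξ⟩

namespace AdoptedData

variable {U V : TopologicalSpace.Opens M} (D : AdoptedData r F ξ U) (D' : AdoptedData r F ξ V)

theorem F_eq (q : U) : F q = normalForm D.g D.ν (height (F q), D.ρ q) := by
  have h := D.g_comp q
  rw [D.ξ_eq] at h
  simp only [normalForm]
  rw [h]
  simp

/-- The definition of an adopted set ties ν_U to ξ on Σ_U only. Elsewhere F = G_U ∘ Φ_U, and Φ_U is
a diffeomorphism, so some tangent vector has dF-image (1, ν_U). Orthogonality to ξ gives two unit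
vectors with inner product 1. -/
theorem ν_ρ (hr0 : r ≠ 0) (hF : ContMDiff 𝓘(ℝ, Euc (k + 1)) 𝓘(ℝ, Mink (k + 1)) r F)
    (hξ : IsENormal 𝓘(ℝ, Euc (k + 1)) r F ξ) (q : U) : D.ν (D.ρ q) = (ξ q).2 := by
  have hG := contMDiff_normalForm D.front.2.2.contMDiff D.front.1
  let J := 𝓘(ℝ, ℝ).prod 𝓘(ℝ, Euc k)
  let z := D.Φ q
  let w : TangentSpace J (z : ℝ × D.S) := ((1 : ℝ), (0 : Euc k))
  obtain ⟨w', hw'⟩ := mfderiv_subtype_val_surjective (I := J) hr0 _ z w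
  obtain ⟨v, hv⟩ : ∃ v, mfderiv 𝓘(ℝ, Euc (k + 1)) J D.Φ q v = w' :=
    ((D.Φ.mfderivToContinuousLinearEquiv hr0 q).surjective w')
  have h1 : (fun q : U => F q) = fun q => normalForm D.g D.ν (D.Φ q : ℝ × D.S) := by
    funext q
    rw [D.Φ_apply]
    exact D.F_eq q
  have hΦ := D.Φ.contMDiff.mdifferentiableAt (x := q) hr0
  have hval : MDifferentiableAt J J (Subtype.val : slab D.t₀ D.ε D.S → ℝ × D.S) z :=
    (contMDiff_subtype_val (n := r)).mdifferentiableAt hr0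
  have hGz : MDifferentiableAt J 𝓘(ℝ, Mink (k + 1)) (normalForm D.g D.ν) (z : ℝ × D.S) :=
    hG.mdifferentiableAt hr0
  have h2 : dvec 𝓘(ℝ, Euc (k + 1)) (fun q : U => F q) q v = ((1 : ℝ), D.ν (D.ρ q)) := by
    have h0 := dvec_comp_map (f := fun z : slab D.t₀ D.ε D.S => normalForm D.g D.ν (z : ℝ × D.S))
      (s := D.Φ) (hGz.comp _ hval) hΦ v
    rw [hv] at h0
    rw [h1, h0, dvec_comp_map hGz hval, hw',
      dvec_normalForm hr0 D.front.2.2.contMDiff D.front.1]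
    refine Prod.ext rfl ?_
    have h3 : (z : ℝ × D.S).2 = D.ρ q := congrArg Prod.snd (D.Φ_apply q)
    have h4 : ∀ f : D.S → Euc (k + 1), dvec 𝓘(ℝ, Euc k) f (z : ℝ × D.S).2 (0 : Euc k) = 0 :=
      fun f => map_zero _
    simp only [w, h4, smul_zero, add_zero, zero_add, one_smul]
    rw [h3]
  have h5 := dvec_comp_map (s := (Subtype.val : U → M)) (hF.mdifferentiableAt hr0)
    ((contMDiff_subtype_val (n := r)).mdifferentiableAt (x := q) hr0) v
  have h6 := hξ.normal q
    (mfderiv 𝓘(ℝ, Euc (k + 1)) 𝓘(ℝ, Euc (k + 1)) (Subtype.val : U → M) q v)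
  rw [← h5, h2, (hξ.eq_mk q).1, lorentz_apply] at h6
  simp only at h6
  refine ((inner_eq_one_iff_of_norm_eq_one (𝕜 := ℝ) (hξ.eq_mk q).2 (D.front.2.1 _)).1 ?_).symm
  linarith

theorem l_ρ (hr0 : r ≠ 0) (hF : ContMDiff 𝓘(ℝ, Euc (k + 1)) 𝓘(ℝ, Mink (k + 1)) r F)
    (hξ : IsENormal 𝓘(ℝ, Euc (k + 1)) r F ξ) (q : U) : D.l (D.ρ q) = lineMap F ξ q := by
  have h1 := D.ν_ρ hr0 hF hξ q
  refine Prod.ext ?_ h1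
  have h2 := congrArg Prod.snd (D.g_comp q)
  rw [D.ξ_eq, h1, height_eq] at h2
  exact h2

theorem map_ρ (q : U) : map D.ρ (𝓝 q) = 𝓝 (D.ρ q) := by
  have h : D.ρ = fun q => (D.Φ q : ℝ × D.S).2 := by
    funext q; rw [D.Φ_apply]
  have ho : IsOpenMap D.ρ := by
    rw [h]
    exact isOpenMap_snd.comp ((slab D.t₀ D.ε D.S).isOpen.isOpenMap_subtype_val.comp
      D.Φ.toHomeomorph.isOpenMap)
  exact ho.map_nhds_eq D.ρ_submersion.1.continuous.continuousAt

/-- Since ρ_U is open and l_U ∘ ρ_U is the restriction of `lineMap`, the germ of l_U at ρ_U(q) does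
not depend on the adopted data. -/
theorem map_lineMap (hr0 : r ≠ 0) (hF : ContMDiff 𝓘(ℝ, Euc (k + 1)) 𝓘(ℝ, Mink (k + 1)) r F)
    (hξ : IsENormal 𝓘(ℝ, Euc (k + 1)) r F ξ) (q : U) :
    map (lineMap F ξ) (𝓝 (q : M)) = map D.l (𝓝 (D.ρ q)) := by
  rw [← D.map_ρ, map_map, ← U.isOpenEmbedding'.map_nhds_eq q, map_map]
  congr 1
  funext q
  exact (D.l_ρ hr0 hF hξ q).symm

/-- With `map_L_eq_map_l`, this shows that the germs of l_U and of L_U determine each other, at any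
given height t. -/
theorem map_l_eq_map_L (t : ℝ) (x : D.S) :
    map D.l (𝓝 x) = map (fun z : Mink (k + 1) × Mink (k + 1) => (z.1.2 - z.1.1 • z.2.2, z.2.2))
      (map D.L (𝓝 (t, x))) := by
  rw [map_map, ← map_snd_nhds (t, x), map_map]
  congr 1
  funext z
  rw [comp_apply, comp_apply, AdoptedData.L, legendrianLift_normalForm]
  exact Prod.ext (add_sub_cancel_right _ _).symm rfl

theorem map_L_eq_map_l (t : ℝ) (x : D.S) :
    map D.L (𝓝 (t, x)) = map (fun z : ℝ × (Euc (k + 1) × Euc (k + 1)) =>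
      ((z.1, z.2.1 + z.1 • z.2.2), ((1 : ℝ), z.2.2))) (𝓝 t ×ˢ map D.l (𝓝 x)) := by
  have h : 𝓝 t ×ˢ map D.l (𝓝 x) = map (Prod.map id D.l) (𝓝 (t, x)) := by
    rw [nhds_prod_eq, ← prod_map_map_eq', map_id]
  rw [h, map_map]
  congr 1
  funext z
  rw [comp_apply, AdoptedData.L, legendrianLift_normalForm]
  rfl

/-- Submanifolds of dimension `k` of the `2 k + 1`-dimensional manifold `ℝⁿ × Sⁿ⁻¹` are transversal
only if they are disjoint. -/
theorem Transversal.l_ne (h : D.Transversal D') (x : D.S) (y : D'.S) : D.l x ≠ D'.l y := by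
  intro hxy
  have h1 := h x y hxy
  let A : Euc k →L[ℝ] Euc (k + 1) × Euc (k + 1) :=
    mfderiv 𝓘(ℝ, Euc k) 𝓘(ℝ, Euc (k + 1) × Euc (k + 1)) D.l x
  let B : Euc k →L[ℝ] Euc (k + 1) × Euc (k + 1) :=
    mfderiv 𝓘(ℝ, Euc k) 𝓘(ℝ, Euc (k + 1) × Euc (k + 1)) D'.l y
  -- At a common point the two tangent spaces together with the line of (0, ν) would span ℝⁿ × ℝⁿ.
  -- But the source has dimension 2k + 1 and the target 2k + 2.
  let C : (Euc k × Euc k) × ℝ →ₗ[ℝ] Euc (k + 1) × Euc (k + 1) :=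
    (A.toLinearMap.coprod B.toLinearMap).coprod
      (LinearMap.toSpanSingleton ℝ (Euc (k + 1) × Euc (k + 1)) (0, D.ν x))
  have hC : Surjective C := by
    rintro ⟨a, b⟩
    have hb : ⟪b - ⟪b, D.ν x⟫_ℝ • D.ν x, D.ν x⟫_ℝ = 0 := by
      rw [inner_sub_left, inner_smul_left, real_inner_self_eq_norm_sq, D.front.2.1]
      simp
    obtain ⟨v, w, hvw⟩ := h1 a _ hb
    refine ⟨((v, w), ⟪b, D.ν x⟫_ℝ), ?_⟩
    have : C ((v, w), ⟪b, D.ν x⟫_ℝ)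
        = (a, b - ⟪b, D.ν x⟫_ℝ • D.ν x) + ⟪b, D.ν x⟫_ℝ • (0, D.ν x) := by
      rw [← hvw]; rfl
    rw [this]
    simp
  have := LinearMap.finrank_le_finrank_of_surjective hC
  simp only [Module.finrank_prod, Module.finrank_self, finrank_euclideanSpace, Fintype.card_fin]
    at this
  omega

end AdoptedData

/-- For embeddings, being related is equality of pushed-forward neighbourhood filters. These pass
from L_U to l_U and from there to `lineMap`, so neither the adopted sets nor the heights matter. In
particular ≈ is an equivalence relation. -/
theorem approx_iff_sameGerm [IsManifold 𝓘(ℝ, Euc (k + 1)) r M] (hr : 2 ≤ r)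
    (hF : IsNullFront 𝓘(ℝ, Euc (k + 1)) r F) (hξ : IsENormal 𝓘(ℝ, Euc (k + 1)) r F ξ) (p q : M) :
    Approx r F ξ p q ↔ SameGerm (lineMap F ξ) p q := by
  have hr0 : r ≠ 0 := (zero_lt_two.trans_le hr).ne'
  have hFc := hF.contMDiff
  constructor
  · rintro ⟨s, t, U, V, hp, hq, D, D', hD, hD', h⟩
    have h1 := (related_iff_map_nhds_eq hD.2 hD'.2 h.choose_spec.choose_spec.2.2.2.2.1).1 h
    have h2 : D.l (D.ρ ⟨p, hp⟩) = D'.l (D'.ρ ⟨q, hq⟩) := by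
      obtain ⟨-, -, -, -, -, -, h3, -⟩ := h
      rw [AdoptedData.L, AdoptedData.L, legendrianLift_normalForm, legendrianLift_normalForm] at h3
      simp only [Prod.mk.injEq, true_and] at h3
      obtain ⟨⟨h4, h5⟩, h6⟩ := h3
      rw [h4, h6] at h5
      exact Prod.ext (add_right_cancel h5) h6
    rw [D.l_ρ hr0 hFc hξ, D'.l_ρ hr0 hFc hξ] at h2
    refine ⟨h2, ?_⟩
    rw [D.map_lineMap hr0 hFc hξ ⟨p, hp⟩, D'.map_lineMap hr0 hFc hξ ⟨q, hq⟩, D.map_l_eq_map_L s,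
      D'.map_l_eq_map_L t, h1]
  · rintro ⟨h1, h2⟩
    obtain ⟨U, D, hp, hD⟩ := exists_strong_adopted hr hF hξ p
    obtain ⟨V, D', hq, hD'⟩ := exists_strong_adopted hr hF hξ q
    -- Any common height would serve; the heights must agree because L records them.
    refine ⟨0, 0, U, V, hp, hq, D, D', hD, hD', (related_iff_map_nhds_eq hD.2 hD'.2 ?_).2 ?_⟩
    · have h3 : D.l (D.ρ ⟨p, hp⟩) = D'.l (D'.ρ ⟨q, hq⟩) := by
        rw [D.l_ρ hr0 hFc hξ, D'.l_ρ hr0 hFc hξ]; exact h1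
      have h4 : D.g (D.ρ ⟨p, hp⟩) = D'.g (D'.ρ ⟨q, hq⟩) := congrArg Prod.fst h3
      have h5 : D.ν (D.ρ ⟨p, hp⟩) = D'.ν (D'.ρ ⟨q, hq⟩) := congrArg Prod.snd h3
      rw [AdoptedData.L, AdoptedData.L, legendrianLift_normalForm, legendrianLift_normalForm]
      simp only [h4, h5]
    · rw [D.map_lineMap hr0 hFc hξ ⟨p, hp⟩, D'.map_lineMap hr0 hFc hξ ⟨q, hq⟩] at h2
      rw [D.map_L_eq_map_l, D'.map_L_eq_map_l, h2]

/-- For an admissible front, `≈` is equality of light-like lines. -/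
theorem IsAdmissible.sameGerm [IsManifold 𝓘(ℝ, Euc (k + 1)) r M] (hr : 2 ≤ r)
    (hF : IsNullFront 𝓘(ℝ, Euc (k + 1)) r F) (hξ : IsENormal 𝓘(ℝ, Euc (k + 1)) r F ξ)
    (hadm : IsAdmissible r F ξ) (p q : M) (h : lineMap F ξ p = lineMap F ξ q) :
    SameGerm (lineMap F ξ) p q := by
  have hr0 : r ≠ 0 := (zero_lt_two.trans_le hr).ne'
  rcases hadm p q with h1 | ⟨U, V, D, D', hp, hq, -, -, ht⟩
  · exact (approx_iff_sameGerm hr hF hξ p q).1 h1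
  · refine absurd ?_ (AdoptedData.Transversal.l_ne D D' ht (D.ρ ⟨p, hp⟩) (D'.ρ ⟨q, hq⟩))
    rw [D.l_ρ hr0 hF.contMDiff hξ, D'.l_ρ hr0 hF.contMDiff hξ]
    exact h

end Adopted

/-! ### Injective local diffeomorphisms -/

section Range

variable {E H M : Type*} [NormedAddCommGroup E] [NormedSpace ℝ E] [TopologicalSpace H]
  {I : ModelWithCorners ℝ E H} [TopologicalSpace M] [ChartedSpace H M]
variable {E' H' N : Type*} [NormedAddCommGroup E'] [NormedSpace ℝ E'] [TopologicalSpace H']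
  {J : ModelWithCorners ℝ E' H'} [TopologicalSpace N] [ChartedSpace H' N] {r : WithTop ℕ∞}

/-- An injective local diffeomorphism is a diffeomorphism onto its open image. -/
theorem exists_diffeomorph_range {f : M → N} (hf : IsLocalDiffeomorph I J r f)
    (hinj : Injective f) :
    ∃ (O : TopologicalSpace.Opens N) (e : M ≃ₘ^r⟮I, J⟯ O),
      (O : Set N) = range f ∧ ∀ p, (e p : N) = f p := by
  let O : TopologicalSpace.Opens N := ⟨range f, hf.isOpen_range⟩
  let e : M ≃ O := Equiv.ofInjective f hinj
  have he : ∀ p, (e p : N) = f p := fun p => rfl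
  refine ⟨O, ⟨e, (contMDiff_subtypeVal_comp_iff O e).1 hf.contMDiff, fun y => ?_⟩, rfl, he⟩
  obtain ⟨x, rfl⟩ := e.surjective y
  have h1 : ContMDiffAt J I r (hf x).localInverse (f x) := (hf x).localInverse_contMDiffAt
  have h2 : ContMDiffAt J I r (fun z : O => (hf x).localInverse (z : N)) (e x) :=
    h1.comp (e x) (contMDiff_subtype_val (e x))
  refine h2.congr_of_eventuallyEq ?_
  have h3 : ∀ᶠ z : O in nhds (e x), (z : N) ∈ (hf x).localInverse.source :=
    continuous_subtype_val.continuousAt ((hf x).localInverse.open_source.mem_nhds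
      (hf x).localInverse_mem_source)
  filter_upwards [h3] with z hz
  apply e.injective
  change e (e.symm z) = _
  rw [e.apply_symm_apply]
  exact Subtype.ext ((hf x).localInverse_right_inv hz).symm

end Range

/-! ### L-completeness of the normal form -/

section LComplete

variable {n : ℕ} {E H S : Type*} [NormedAddCommGroup E] [NormedSpace ℝ E] [TopologicalSpace H]
  {J : ModelWithCorners ℝ E H} [TopologicalSpace S] [ChartedSpace H S] {r : WithTop ℕ∞}
  {g ν : S → Euc n}

/-- The null field is ∂/∂t, whose integral curves t ↦ (t, x) are complete and are mapped to the full
lines of the normal form. -/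
theorem isLComplete_normalForm (hr : r = ∞ ∨ r = ω) [IsManifold J r S]
    (h : IsFrontWithUnitNormal J r g ν) :
    IsLComplete (𝓘(ℝ, ℝ).prod J) r hr (normalForm g ν) (normalFormField ν) := by
  have hr1 := one_le_of_smooth_or_analytic hr
  have hr0 : r ≠ 0 := (zero_lt_one.trans_le hr1).ne'
  have : IsManifold J 1 S := IsManifold.of_le hr1
  refine ⟨fun _ => ((1 : ℝ), (0 : E)), ?_, fun z => ?_, fun z => ?_⟩
  · have h1 : ContMDiff 𝓘(ℝ, ℝ) 𝓘(ℝ, ℝ).tangent r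
        (fun t : ℝ => (⟨t, (1 : ℝ)⟩ : TangentBundle 𝓘(ℝ, ℝ) ℝ)) :=
      contMDiff_vectorSpace_iff_contDiff.2 contDiff_const
    have h2 : ContMDiff J J.tangent r (fun x : S => (⟨x, (0 : E)⟩ : TangentBundle J S)) :=
      Bundle.contMDiff_zeroSection ℝ (TangentSpace J : S → Type _)
    exact contMDiff_equivTangentBundleProd_symm.comp
      ((h1.comp contMDiff_fst).prodMk (h2.comp contMDiff_snd))
  · have h1 := dvec_normalForm hr0 h.2.2.contMDiff h.1 z ((1 : ℝ), (0 : E))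
    have h2 : ∀ f : S → Euc n, dvec J f z.2 (0 : E) = 0 := fun f => map_zero _
    refine h1.trans (Prod.ext rfl ?_)
    simp [h2, normalFormField]
  · refine ⟨fun t => (t, z.2), fun t => ?_, ⟨z.1, rfl⟩, normalForm g ν (0, z.2),
      normalFormField ν z, ?_, lorentz_normalFormField h.2.1 z, ?_⟩
    · have h1 : HasMFDerivAt 𝓘(ℝ, ℝ) (𝓘(ℝ, ℝ).prod J) (fun t : ℝ => (t, z.2)) t _ :=
        (hasMFDerivAt_id t).prodMk (hasMFDerivAt_const z.2 t)
      have h2 : (1 : ℝ →L[ℝ] ℝ).smulRight ((1 : ℝ), (0 : E))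
          = (ContinuousLinearMap.id ℝ ℝ).prod (0 : ℝ →L[ℝ] E) := by
        ext <;> simp
      exact h1.congr_mfderiv h2.symm
    · intro h0
      exact one_ne_zero (congrArg Prod.fst h0)
    · congr 1
      funext t
      simp [normalForm, normalFormField]

end LComplete

end NullFront

/-! ### Construction of the L-completion -/

theorem theorem3p17 {k : ℕ} {M : Type u} [TopologicalSpace M] [T2Space M]
    [SecondCountableTopology M] [ChartedSpace (NullFront.Euc (k + 1)) M]
    (r : WithTop ℕ∞) (hr : r = ∞ ∨ r = ω) [IsManifold 𝓘(ℝ, NullFront.Euc (k + 1)) r M]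
    (F ξ : M → NullFront.Mink (k + 1))
    (hF : NullFront.IsNullFront 𝓘(ℝ, NullFront.Euc (k + 1)) r F)
    (hξ : NullFront.IsENormal 𝓘(ℝ, NullFront.Euc (k + 1)) r F ξ)
    (hadm : r = ω ∨ NullFront.IsAdmissible r F ξ) :
    ∃ (S : Type u) (_ : TopologicalSpace S) (_ : T2Space S) (_ : SecondCountableTopology S)
      (_ : ChartedSpace (NullFront.Euc k) S) (_ : IsManifold 𝓘(ℝ, NullFront.Euc k) r S)
      (ρ : M → S) (g ν : S → NullFront.Euc (k + 1)),
      -- `S` is the quotient of `M` by `≈`, and `ρ` is the projection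
      Surjective ρ ∧ (∀ p q : M, ρ p = ρ q ↔ NullFront.Approx r F ξ p q) ∧
      NullFront.IsCrSubmersion 𝓘(ℝ, NullFront.Euc (k + 1)) 𝓘(ℝ, NullFront.Euc k) r ρ ∧
      -- `G` is a normal form, and an L-complete null wave front
      NullFront.IsFrontWithUnitNormal 𝓘(ℝ, NullFront.Euc k) r g ν ∧
      NullFront.IsNullFront (𝓘(ℝ, ℝ).prod 𝓘(ℝ, NullFront.Euc k)) r
        (NullFront.normalForm g ν) ∧
      NullFront.IsENormal (𝓘(ℝ, ℝ).prod 𝓘(ℝ, NullFront.Euc k)) r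
        (NullFront.normalForm g ν) (NullFront.normalFormField ν) ∧
      NullFront.IsLComplete (𝓘(ℝ, ℝ).prod 𝓘(ℝ, NullFront.Euc k)) r hr
        (NullFront.normalForm g ν) (NullFront.normalFormField ν) ∧
      -- `Φ = (τ ∘ F, ρ)` is an immersion, and `L_F = L_G ∘ Φ`
      NullFront.IsCrImmersion 𝓘(ℝ, NullFront.Euc (k + 1))
        (𝓘(ℝ, ℝ).prod 𝓘(ℝ, NullFront.Euc k)) r
        (fun p : M => (NullFront.height (F p), ρ p)) ∧
      (∀ p : M, NullFront.legendrianLift F ξ p =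
        NullFront.legendrianLift (NullFront.normalForm g ν) (NullFront.normalFormField ν)
          (NullFront.height (F p), ρ p)) ∧
      -- if `L_F` is an embedding, then `Φ` is a diffeomorphism onto its (open) image
      (NullFront.IsCrEmbedding 𝓘(ℝ, NullFront.Euc (k + 1))
          𝓘(ℝ, NullFront.Mink (k + 1) × NullFront.Mink (k + 1)) r
          (NullFront.legendrianLift F ξ) →
        ∃ (O : TopologicalSpace.Opens (ℝ × S))
          (e : M ≃ₘ^r⟮𝓘(ℝ, NullFront.Euc (k + 1)), 𝓘(ℝ, ℝ).prod 𝓘(ℝ, NullFront.Euc k)⟯ O),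
          (O : Set (ℝ × S)) = range (fun p : M => (NullFront.height (F p), ρ p)) ∧
          ∀ p : M, (e p : ℝ × S) = (NullFront.height (F p), ρ p)) := by
  open NullFront in
  have hr2 := two_le_of_smooth_or_analytic hr
  have hr0 : r ≠ 0 := (zero_lt_two.trans_le hr2).ne'
  have hFc := hF.contMDiff
  have hl := contMDiff_lineMap hFc hξ
  have hbox := exists_frontBox hr2 hF hξ
  let S := GermSpace (lineMap F ξ)
  let _ : ChartedSpace (Euc k) S := GermSpace.chartedSpace hl.continuous hbox
  have hS : IsManifold 𝓘(ℝ, Euc k) r S := GermSpace.isManifold hl hbox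
  let ρ : M → S := GermSpace.mk (lineMap F ξ)
  let g : S → Euc (k + 1) := fun s => (GermSpace.lift s).1
  let ν : S → Euc (k + 1) := fun s => (GermSpace.lift s).2
  have hρ : ContMDiff 𝓘(ℝ, Euc (k + 1)) 𝓘(ℝ, Euc k) r ρ := GermSpace.contMDiff_mk hl hbox
  have hlift : ContMDiff 𝓘(ℝ, Euc k) 𝓘(ℝ, Euc (k + 1) × Euc (k + 1)) r
      (GermSpace.lift : S → Euc (k + 1) × Euc (k + 1)) := GermSpace.contMDiff_lift hl hbox
  have hg : ContMDiff 𝓘(ℝ, Euc k) 𝓘(ℝ, Euc (k + 1)) r g :=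
    (ContinuousLinearMap.fst ℝ (Euc (k + 1)) (Euc (k + 1))).contMDiff.comp hlift
  have hν : ContMDiff 𝓘(ℝ, Euc k) 𝓘(ℝ, Euc (k + 1)) r ν :=
    (ContinuousLinearMap.snd ℝ (Euc (k + 1)) (Euc (k + 1))).contMDiff.comp hlift
  have hτ := contMDiff_height hFc
  have hΦ : IsLocalDiffeomorph 𝓘(ℝ, Euc (k + 1)) (𝓘(ℝ, ℝ).prod 𝓘(ℝ, Euc k)) r
      (fun p : M => ((F p).1, ρ p)) := GermSpace.isLocalDiffeomorph hl hbox hτ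
  have hdΦ : ∀ p (v : TangentSpace 𝓘(ℝ, Euc (k + 1)) p),
      mfderiv 𝓘(ℝ, Euc (k + 1)) (𝓘(ℝ, ℝ).prod 𝓘(ℝ, Euc k)) (fun p : M => ((F p).1, ρ p)) p v
        = (dvec 𝓘(ℝ, Euc (k + 1)) (fun p => (F p).1) p v,
          mfderiv 𝓘(ℝ, Euc (k + 1)) 𝓘(ℝ, Euc k) ρ p v) := fun p v => by
    rw [mfderiv_prodMk (hτ.mdifferentiableAt hr0) (hρ.mdifferentiableAt hr0)]
    rfl
  have hdΦs : ∀ p, Surjective (mfderiv 𝓘(ℝ, Euc (k + 1)) (𝓘(ℝ, ℝ).prod 𝓘(ℝ, Euc k))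
      (fun p : M => ((F p).1, ρ p)) p) := fun p =>
    (hΦ.mfderivToContinuousLinearEquiv hr0 p).surjective
  have hdΦi : ∀ p, Injective (mfderiv 𝓘(ℝ, Euc (k + 1)) (𝓘(ℝ, ℝ).prod 𝓘(ℝ, Euc k))
      (fun p : M => ((F p).1, ρ p)) p) := fun p =>
    (hΦ.mfderivToContinuousLinearEquiv hr0 p).injective
  -- A tangent vector of the quotient lifts to one of M that does not change the height. For such a
  -- lift w, vanishing of dg and dν on the quotient gives dF(w) = 0 and dν(w) = 0, whence w = 0 in
  -- `hfront`.
  have hdρ : ∀ p (v : TangentSpace 𝓘(ℝ, Euc k) (ρ p)), ∃ w,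
      dvec 𝓘(ℝ, Euc (k + 1)) (fun p => (F p).1) p w = 0 ∧
      mfderiv 𝓘(ℝ, Euc (k + 1)) 𝓘(ℝ, Euc k) ρ p w = v := fun p v => by
    obtain ⟨w, hw⟩ := hdΦs p ((0 : ℝ), v)
    rw [hdΦ] at hw
    exact ⟨w, congrArg Prod.fst hw, congrArg Prod.snd hw⟩
  have hgρ : ∀ p (w : TangentSpace 𝓘(ℝ, Euc (k + 1)) p),
      dvec 𝓘(ℝ, Euc (k + 1)) (footpoint F (fun p => (ξ p).2)) p w
        = dvec 𝓘(ℝ, Euc k) g (ρ p) (mfderiv 𝓘(ℝ, Euc (k + 1)) 𝓘(ℝ, Euc k) ρ p w) := fun p w =>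
    dvec_comp_map (f := g) (s := ρ) (hg.mdifferentiableAt hr0) (hρ.mdifferentiableAt hr0) w
  have hνρ : ∀ p (w : TangentSpace 𝓘(ℝ, Euc (k + 1)) p),
      dvec 𝓘(ℝ, Euc (k + 1)) (fun p => (ξ p).2) p w
        = dvec 𝓘(ℝ, Euc k) ν (ρ p) (mfderiv 𝓘(ℝ, Euc (k + 1)) 𝓘(ℝ, Euc k) ρ p w) := fun p w =>
    dvec_comp_map (f := ν) (s := ρ) (hν.mdifferentiableAt hr0) (hρ.mdifferentiableAt hr0) w
  have hfront : IsFrontWithUnitNormal 𝓘(ℝ, Euc k) r g ν := by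
    refine isFrontWithUnitNormal_of_immersion hr0 hg hν (fun s => ?_) (fun s v => ?_)
      fun s v h1 h2 => ?_ <;> obtain ⟨p, rfl⟩ := GermSpace.mk_surjective s
    · exact (hξ.eq_mk p).2
    · obtain ⟨w, -, rfl⟩ := hdρ p v
      have h3 := inner_dvec_footpoint_eNormal hr0 hFc hξ p w
      rw [hgρ] at h3
      exact h3
    · obtain ⟨w, h0, rfl⟩ := hdρ p v
      have h3 : dvec 𝓘(ℝ, Euc (k + 1)) (footpoint F (fun p => (ξ p).2)) p w = 0 :=
        (hgρ p w).trans h1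
      have h4 : dvec 𝓘(ℝ, Euc (k + 1)) (fun p => (ξ p).2) p w = 0 := (hνρ p w).trans h2
      rw [dvec_height hFc hr0] at h0
      rw [dvec_footpoint hFc hξ.contMDiff_snd hr0, h0, h4, zero_smul, smul_zero, add_zero,
        sub_zero] at h3
      rw [(hF.tangent_and_immersion hr2 hξ p).2 w (Prod.ext h0 h3) h4]
      exact map_zero _
  have hheight : (fun p : M => (height (F p), ρ p)) = fun p => ((F p).1, ρ p) := by
    funext p; rw [height_eq]
  have hLG : ∀ p : M, legendrianLift F ξ p =
      legendrianLift (normalForm g ν) (normalFormField ν) (height (F p), ρ p) := fun p => by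
    rw [legendrianLift_eq hξ, legendrianLift_normalForm, height_eq]
    rfl
  refine ⟨S, inferInstance,
    GermSpace.t2Space hl hbox (hadm.imp_right fun h => h.sameGerm hr2 hF hξ),
    GermSpace.secondCountableTopology hl.continuous hbox, inferInstance, hS, ρ, g, ν,
    GermSpace.mk_surjective, fun p q => ?_, ⟨hρ, fun p v => ?_⟩, hfront,
    isNullFront_normalForm hr0 hfront, isENormal_normalForm hr0 hfront,
    isLComplete_normalForm hr hfront, ?_, hLG, fun hemb => ?_⟩
  · exact GermSpace.mk_eq_mk.trans (approx_iff_sameGerm hr2 hF hξ p q).symm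
  · obtain ⟨w, -, hw⟩ := hdρ p v
    exact ⟨w, hw⟩
  · rw [hheight]
    exact ⟨hΦ.contMDiff, hdΦi⟩
  -- Φ is injective because L_F = L_G ∘ Φ is; being also a local diffeomorphism, it is a
  -- diffeomorphism onto an open set.
  · obtain ⟨O, e, h1, h2⟩ := exists_diffeomorph_range hΦ fun p q hpq => hemb.2.injective (by
      rw [hLG, hLG, height_eq, height_eq]
      exact congrArg _ hpq)
    rw [hheight]
    exact ⟨O, e, h1, fun p => by rw [h2, height_eq]⟩
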